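/- Let $A=\mathbb C^g/\Lambda$ be a complex abelian variety with a principal polarization given by a positive definite Hermitian form $H$ on $\mathbb C^g$, let $\lambda_1,\dots,\lambda_{2g}$ be a basis of $\Lambda$ that is symplectic for $\mathrm{Im}\,H$, and let $A^*=\mathrm{Hom}_{\overline{\mathbb C}}(\mathbb C^g,\mathbb C)/\Lambda^*$ be the dual variety, identified with $\mathbb C^g/\Lambda$ through $\phi_H(z)=H(z,\cdot)$. Let $\theta$ be an entire function on $\mathbb C^g$ such that for each $\lambda\in\Lambda$ the quotient $\theta(z+\lambda)/\big(\theta(z)e^{\pi H(z,\lambda)+\frac{\pi}{2}H(\lambda,\lambda)}\big)$ is constant, with $\theta(0)=1$ and $d\theta(0)=0$. Put $d\log\theta=\sum_j h_j\,dz_j$, $\omega_j=dz_j$, $\eta_j=dh_j$ and $$F_q(z)=\frac{\theta(z+q)}{\theta(z)\theta(q)}\,e^{-\sum_j h_j(q)z_j}.$$ Let $P_1,\dots,P_n\in A$ and $Q_1,\dots,Q_s\in A^*$ with logarithms $p_i,q_k\in\mathbb C^g$ (so that $\phi_H(q_k)$ is a logarithm of $Q_k$) which are not zeros of $\theta$.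 Let $\psi(x_i,y_k)$ be points of the Poincaré $\mathbb G_m$-torsor over $(P_i,Q_k)$, and let $M=[\mathbb Z^n\to G]$ and $M^*=[\mathbb Z^s\to G^*]$ be the corresponding 1-motive and its Cartier dual: $G$ is the extension of $A$ by $\mathbb G_m^s$ parameterized by the $Q_k$, $G^*$ is the extension of $A^*$ by $\mathbb G_m^n$ parameterized by the $P_i$, and the points $R_i\in G$ above $P_i$ and $R_k^*\in G^*$ above $Q_k$ are those whose components are the points $\psi(x_i,y_k)$. The exponential map of $G$ is $(z,t)\mapsto(\exp_A(z),(Z_k)_k)$ with $Z_k=e^{t_k}F_{q_k}(z)$; put $\tilde\xi_{Q_k}=dZ_k/Z_k$, let $\xi_{Q_k}$ be the form on $A$ with pull-back $d\log F_{q_k}$, and let $\xi^G_{Q_k}=-\tilde\xi_{Q_k}+\pi^*\xi_{Q_k}$; similarly for $G^*$, with the $p_i$ in place of the $q_k$. Let $\gamma_1,\dots,\gamma_{2g}$ be loops on $G$, and also on $G^*$, above $\lambda_1,\dots,\lambda_{2g}$, and let $[O,R_i]$, $[O,R^*_k]$ be paths on $G$, $G^*$ that lift to paths in the Lie algebras from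 $0$ to logarithms of $R_i$, $R_k^*$ above $p_i$, $q_k$ (all paths are $C^1$ and their projections to $\mathbb C^g$ avoid the zeros of $\theta$). For $i\le n$, $k\le s$ and $j\le g$ define the matrices (the entries of $\widetilde{\log}$ being integrals along $[O,R_i]$ and $[O,R_k^*]$) $$\Pi_A=\Big(\int_{\gamma_l}\omega_j\ \Big|\ \int_{\gamma_l}\eta_j\Big)_{l\le 2g,\,j},\qquad \Pi_{A^*}=\begin{pmatrix}\int_{\gamma_{g+l}}\eta_j&-\int_{\gamma_{g+l}}\omega_j\\-\int_{\gamma_l}\eta_j&\int_{\gamma_l}\omega_j\end{pmatrix}_{l,j\le g},$$ $$\widetilde{\log}_A(P)=\Big(\int_0^{p_i}\omega_j\ \Big|\ \int_0^{p_i}\eta_j\Big)_{i,j},\qquad \widetilde{\log}_{A^*}(Q)=\Big(\int_0^{q_k}\eta_j\ \Big|\ -\int_0^{q_k}\omega_j\Big)_{k,j},$$ $$\Upsilon_Q=\Big(\int_{\gamma_l}\xi^G_{Q_k}\Big)_{l\le 2g,\,k},\qquad \Upsilon_P=\begin{pmatrix}-\int_{\gamma_{g+l}}\xi^{G^*}_{P_i}\\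 \int_{\gamma_l}\xi^{G^*}_{P_i}\end{pmatrix}_{l\le g,\,i},\qquad \Xi_R=\Big(\int_O^{R_i}\xi^G_{Q_k}\Big)_{i,k},\qquad \Xi_{R^*}=\Big(-\int_O^{R^*_k}\xi^{G^*}_{P_i}\Big)_{k,i}.$$ Write $\int_{\gamma_l}\tilde\xi_{Q_k}=\int_{\gamma_l}dt_k+\log\frac{F_{q_k}(z+\lambda_l)}{F_{q_k}(z)}$, where the logarithm is the determination obtained by continuity from the value $0$ at $F_0=1$ when $q_k$ is deformed to $0$ within the complement of the zeros of $\theta$; similarly for $\int_{\gamma_l}\tilde\xi_{P_i}$ on $G^*$. Write $\int_O^{R_i}\tilde\xi_{Q_k}-\int_O^{R_k^*}\tilde\xi_{P_i}=\int_{[O,R_i]}dt_k-\int_{[O,R_k^*]}dt_i+\log\frac{F_{q_k}(p_i)}{F_{p_i}(q_k)}$, where the logarithm is the determination obtained by continuity from the value $0$ at $(0,0)$ when $(p_i,q_k)$ is deformed to $(0,0)$, the two points staying outside the zeros of $\theta$ and their sum too, except possibly at the end $(p_i,q_k)$. Then: 1. $\Upsilon_Q=-\Pi_A\,\widetilde{\log}_{A^*}(Q)^t$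 if $\int_{\gamma_l}\tilde\xi_{Q_k}=0$ for all $l,k$; 2. $\Upsilon_P=-\Pi_{A^*}\,\widetilde{\log}_A(P)^t$ if $\int_{\gamma_l}\tilde\xi_{P_i}=0$ for all $l,i$; 3. $\Xi_R^t+\Xi_{R^*}=-\widetilde{\log}_{A^*}(Q)\,\widetilde{\log}_A(P)^t$ if $\int_O^{R_i}\tilde\xi_{Q_k}-\int_O^{R_k^*}\tilde\xi_{P_i}=0$ for all $i,k$. Loops and paths with these normalizations exist, and for arbitrary loops and paths the three relations hold modulo $2\mathrm i\pi\mathbb Z$, entry by entry. The conditions $\int_{\gamma_l}\tilde\xi_{Q_k}=0$, $\int_{\gamma_l}\tilde\xi_{P_i}=0$ and $\int_O^{R_i}\tilde\xi_{Q_k}-\int_O^{R_k^*}\tilde\xi_{P_i}=0$ are equivalent to the same conditions on the integrals of $\tilde\xi$ along the actual paths whenever $\theta$ has no zero at the points $c(t)+b(u)$, $t,u\in[0,1]$, where in the first two cases $c$ is the projection to $\mathbb C^g$ of the lift of the loop and $b$ is some path from $0$ to $q_k$ (to $p_i$ respectively) that avoids the zeros of $\theta$, and in the third case $c$ and $b$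 are the projections of the lifts of $[O,R_i]$ and $[O,R_k^*]$. -/

import Mathlib

open scoped unitInterval ComplexConjugate

noncomputable section

/-- A complex abelian variety `ℂ^g / Λ` with a principal polarization: `polar` is the
positive definite Hermitian form `H` (linear in the first variable, antilinear in the second)
and `basis` is a basis `λ_1, …, λ_{2g}` of the lattice `Λ` (`Sum.inl i` is the index `i`,
`Sum.inr i` is the index `g + i`) which is symplectic for `Im H`. -/
structure PPTorus (g : ℕ) where
  polar : (Fin g → ℂ) →ₗ[ℂ] (Fin g → ℂ) →ₗ⋆[ℂ] ℂ
  polar_conj : ∀ z w, polar w z = conj (polar z w)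
  polar_pos : ∀ z, z ≠ 0 → 0 < (polar z z).re
  basis : Module.Basis (Fin g ⊕ Fin g) ℝ (Fin g → ℂ)
  symplectic_inl_inr : ∀ i j,
    (polar (basis (Sum.inl i)) (basis (Sum.inr j))).im = if i = j then 1 else 0
  symplectic_inl_inl : ∀ i j, (polar (basis (Sum.inl i)) (basis (Sum.inl j))).im = 0
  symplectic_inr_inr : ∀ i j, (polar (basis (Sum.inr i)) (basis (Sum.inr j))).im = 0

namespace PPTorus

variable {g : ℕ} (T : PPTorus g)

/-- The lattice `Λ`. -/
def lattice : Submodule ℤ (Fin g → ℂ) := Submodule.span ℤ (Set.range T.basis)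

/-- The abelian variety `A = ℂ^g / Λ`. -/
abbrev A : Type := (Fin g → ℂ) ⧸ T.lattice

/-- The exponential map of `A`. -/
def expA (z : Fin g → ℂ) : T.A := Submodule.Quotient.mk z

/-- The lattice `Λ^*` of antilinear forms `l` with `Im l(Λ) ⊆ ℤ`. -/
def dualLattice : AddSubgroup ((Fin g → ℂ) →ₗ⋆[ℂ] ℂ) where
  carrier := {l | ∀ v ∈ T.lattice, ∃ m : ℤ, (l v).im = m}
  zero_mem' := fun v _ => ⟨0, by simp⟩
  add_mem' := by
    intro a b ha hb v hv
    obtain ⟨m, hm⟩ := ha v hv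
    obtain ⟨k, hk⟩ := hb v hv
    exact ⟨m + k, by simp [hm, hk]⟩
  neg_mem' := by
    intro a ha v hv
    obtain ⟨m, hm⟩ := ha v hv
    exact ⟨-m, by simp [hm]⟩

/-- The dual abelian variety `A^*`, as a quotient of the space of antilinear forms. -/
abbrev Dual : Type := ((Fin g → ℂ) →ₗ⋆[ℂ] ℂ) ⧸ T.dualLattice

/-- The exponential map of `A^*`. -/
def expDual (l : (Fin g → ℂ) →ₗ⋆[ℂ] ℂ) : T.Dual := QuotientAddGroup.mk l

theorem basis_im (x y : Fin g ⊕ Fin g) :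
    ∃ m : ℤ, (T.polar (T.basis x) (T.basis y)).im = m := by
  rcases x with i | i <;> rcases y with j | j
  · exact ⟨0, by simp [T.symplectic_inl_inl]⟩
  · exact ⟨if i = j then 1 else 0, by rw [T.symplectic_inl_inr]; split_ifs <;> simp⟩
  · refine ⟨-(if j = i then 1 else 0), ?_⟩
    rw [T.polar_conj, Complex.conj_im, T.symplectic_inl_inr]
    split_ifs <;> simp
  · exact ⟨0, by simp [T.symplectic_inr_inr]⟩

theorem lattice_im {v w : Fin g → ℂ} (hv : v ∈ T.lattice) (hw : w ∈ T.lattice) :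
    ∃ m : ℤ, (T.polar v w).im = m := by
  induction hv, hw using Submodule.span_induction₂ with
  | mem_mem x y hx hy =>
    obtain ⟨i, rfl⟩ := hx
    obtain ⟨j, rfl⟩ := hy
    exact T.basis_im i j
  | zero_left y hy => exact ⟨0, by simp⟩
  | zero_right x hx => exact ⟨0, by simp⟩
  | add_left x y z hx hy hz h1 h2 =>
    obtain ⟨m, hm⟩ := h1
    obtain ⟨k, hk⟩ := h2
    exact ⟨m + k, by simp [hm, hk]⟩
  | add_right x y z hx hy hz h1 h2 =>
    obtain ⟨m, hm⟩ := h1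
    obtain ⟨k, hk⟩ := h2
    exact ⟨m + k, by simp [hm, hk]⟩
  | smul_left r x y hx hy h =>
    obtain ⟨m, hm⟩ := h
    exact ⟨r * m, by rw [map_zsmul]; simp [hm]⟩
  | smul_right r x y hx hy h =>
    obtain ⟨m, hm⟩ := h
    exact ⟨r * m, by rw [map_zsmul]; simp [hm]⟩

/-- The isomorphism `φ_H = polar` identifies `Λ` with `Λ^*`, hence `ℂ^g / Λ` with `A^*`. -/
theorem polar_mem_dualLattice_iff (z : Fin g → ℂ) :
    T.polar z ∈ T.dualLattice ↔ z ∈ T.lattice := by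
  constructor
  · intro h
    have key : ∀ w, (T.polar z w).im
        = ∑ x, T.basis.repr z x * (T.polar (T.basis x) w).im := by
      intro w
      conv_lhs => rw [← T.basis.sum_repr z]
      rw [map_sum, LinearMap.sum_apply, Complex.im_sum]
      refine Finset.sum_congr rfl fun x _ => ?_
      rw [← Complex.coe_smul, map_smul]
      simp
    have hrl : ∀ i j,
        (T.polar (T.basis (Sum.inr i)) (T.basis (Sum.inl j))).im = -if j = i then 1 else 0 := by
      intro i j
      rw [T.polar_conj, Complex.conj_im, T.symplectic_inl_inr]
    refine (T.basis.mem_span_iff_repr_mem ℤ z).2 fun x => ?_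
    rcases x with i | i
    · obtain ⟨m, hm⟩ := h _ (Submodule.subset_span ⟨Sum.inr i, rfl⟩)
      refine ⟨m, ?_⟩
      rw [key] at hm
      simp only [Fintype.sum_sum_type, T.symplectic_inl_inr, T.symplectic_inr_inr] at hm
      simp at hm
      simp [hm]
    · obtain ⟨m, hm⟩ := h _ (Submodule.subset_span ⟨Sum.inl i, rfl⟩)
      refine ⟨-m, ?_⟩
      rw [key] at hm
      simp only [Fintype.sum_sum_type, T.symplectic_inl_inl, hrl] at hm
      simp at hm
      simp [← hm]
  · intro h v hv
    exact T.lattice_im h hv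

/-- The total space, with its zero section removed, of the Poincaré bundle pulled back to
`ℂ^g × ℂ^g` (the second factor is identified with `Lie A^*` through `polar`) carries the
action of `Λ × Λ` with factor of automorphy
`exp (-π (H(z', v) + H(z, v') + H(v', v)))`; this is the orbit relation. The fibre coordinate
`w` is normalized so that `w θ(z + z') / (θ(z) θ(z'))` is invariant for every theta function `θ`
with form `H`, i.e. this is the coordinate given by the symmetric rational trivialization. -/
def poincareSetoid : Setoid (((Fin g → ℂ) × (Fin g → ℂ)) × ℂˣ) where
  r x y := ∃ v ∈ T.lattice, ∃ v' ∈ T.lattice,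
    y.1.1 = x.1.1 + v ∧ y.1.2 = x.1.2 + v' ∧
    (y.2 : ℂ) = x.2 * Complex.exp (-(Real.pi *
      (T.polar x.1.2 v + T.polar x.1.1 v' + T.polar v' v)))
  iseqv := by
    have hex : ∀ v ∈ T.lattice, ∀ w ∈ T.lattice,
        Complex.exp (Real.pi * T.polar v w) = Complex.exp (Real.pi * T.polar w v) := by
      intro v hv w hw
      obtain ⟨m, hm⟩ := T.lattice_im hv hw
      rw [Complex.exp_eq_exp_iff_exists_int]
      refine ⟨m, ?_⟩
      rw [T.polar_conj v w]
      apply Complex.ext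
      · simp
      · simp [hm]; ring
    refine ⟨fun x => ⟨0, zero_mem _, 0, zero_mem _, by simp, by simp, by simp⟩, ?_, ?_⟩
    · rintro ⟨⟨x1, x2⟩, x3⟩ ⟨⟨y1, y2⟩, y3⟩ ⟨v, hv, v', hv', h1, h2, h3⟩
      refine ⟨-v, neg_mem hv, -v', neg_mem hv', ?_, ?_, ?_⟩
      · simp_all
      · simp_all
      · simp only at h1 h2 h3 ⊢
        rw [h3, h1, h2, mul_assoc, ← Complex.exp_add]
        simp only [map_add, map_neg, LinearMap.add_apply, LinearMap.neg_apply]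
        have : Complex.exp (-(Real.pi * (T.polar x2 v + T.polar x1 v' + T.polar v' v))
            + -(Real.pi * (-(T.polar x2 v + T.polar v' v)
              + -(T.polar x1 v' + T.polar v v') + - -T.polar v' v))) = 1 := by
          have e : -(Real.pi * (T.polar x2 v + T.polar x1 v' + T.polar v' v))
            + -(Real.pi * (-(T.polar x2 v + T.polar v' v)
              + -(T.polar x1 v' + T.polar v v') + - -T.polar v' v))
              = (Real.pi : ℂ) * T.polar v v' - Real.pi * T.polar v' v := by ring
          rw [e, Complex.exp_sub, hex v hv v' hv', div_self (Complex.exp_ne_zero _)]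
        rw [this, mul_one]
    · rintro ⟨⟨x1, x2⟩, x3⟩ ⟨⟨y1, y2⟩, y3⟩ ⟨⟨z1, z2⟩, z3⟩ ⟨v, hv, v', hv', h1, h2, h3⟩
        ⟨w, hw, w', hw', k1, k2, k3⟩
      refine ⟨v + w, add_mem hv hw, v' + w', add_mem hv' hw', ?_, ?_, ?_⟩
      · simp only at h1 k1 ⊢
        rw [k1, h1, add_assoc]
      · simp only at h2 k2 ⊢
        rw [k2, h2, add_assoc]
      · simp only at h1 h2 h3 k3 ⊢
        rw [k3, h3, h1, h2, mul_assoc, ← Complex.exp_add]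
        simp only [map_add, LinearMap.add_apply]
        congr 1
        have e1 : -(Real.pi * (T.polar x2 v + T.polar x1 v' + T.polar v' v))
            + -(Real.pi * (T.polar x2 w + T.polar v' w + (T.polar x1 w' + T.polar v w')
              + T.polar w' w))
            = -((Real.pi : ℂ) * (T.polar x2 v + T.polar x1 v' + T.polar v' v
              + T.polar x2 w + T.polar v' w + T.polar x1 w' + T.polar w' w))
              - Real.pi * T.polar v w' := by ring
        have e2 : -((Real.pi : ℂ) * (T.polar x2 v + T.polar x2 w + (T.polar x1 v' + T.polar x1 w')
            + (T.polar v' v + T.polar w' v + (T.polar v' w + T.polar w' w))))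
            = -((Real.pi : ℂ) * (T.polar x2 v + T.polar x1 v' + T.polar v' v
              + T.polar x2 w + T.polar v' w + T.polar x1 w' + T.polar w' w))
              - Real.pi * T.polar w' v := by ring
        rw [e1, e2, Complex.exp_sub, Complex.exp_sub, hex v hv w' hw']

/-- The Poincaré `𝔾_m`-torsor over `A × A^*`. -/
def Poincare : Type := Quotient T.poincareSetoid

/-- The projection of the Poincaré torsor to `A × A^*`. -/
def Poincare.base : T.Poincare → T.A × T.Dual :=
  Quotient.lift (fun x => (T.expA x.1.1, T.expDual (T.polar x.1.2))) (by
    rintro x y ⟨v, hv, v', hv', h1, h2, -⟩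
    refine Prod.ext ?_ ?_
    · simp only [expA]
      rw [h1, Submodule.Quotient.eq]
      simpa using neg_mem hv
    · simp only [expDual]
      rw [h2, QuotientAddGroup.eq]
      have := (T.polar_mem_dualLattice_iff v').2 hv'
      simpa using this)

/-- The periods of the extension with parameters `r_1, …, r_m`: the pairs
`(v, (exp (-π H(r_k, v)))_k)` with `v ∈ Λ`. -/
def extLattice {m : ℕ} (r : Fin m → Fin g → ℂ) :
    AddSubgroup ((Fin g → ℂ) × (Fin m → Additive ℂˣ)) where
  carrier := {x | x.1 ∈ T.lattice ∧
    ∀ k, ((x.2 k).toMul : ℂ) = Complex.exp (-(Real.pi * T.polar (r k) x.1))}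
  zero_mem' := ⟨zero_mem _, fun k => by simp⟩
  add_mem' := by
    rintro a b ⟨ha, ha'⟩ ⟨hb, hb'⟩
    refine ⟨add_mem ha hb, fun k => ?_⟩
    simp only [Prod.snd_add, Pi.add_apply, toMul_add, Units.val_mul, ha', hb', Prod.fst_add,
      map_add, ← Complex.exp_add]
    congr 1
    ring
  neg_mem' := by
    rintro a ⟨ha, ha'⟩
    refine ⟨neg_mem ha, fun k => ?_⟩
    simp only [Prod.snd_neg, Pi.neg_apply, toMul_neg, Units.val_inv_eq_inv_val, ha',
      Prod.fst_neg, map_neg, ← Complex.exp_neg]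
    congr 1
    ring

/-- The extension of `ℂ^g / Λ` by `𝔾_m^m` parameterized by the points of the dual variety
with logarithms `polar r_1, …, polar r_m`, as a complex Lie group. With `A^*` identified
with `ℂ^g / Λ`, it is also used for the extensions of `A^*` by `𝔾_m^m`. -/
abbrev Ext {m : ℕ} (r : Fin m → Fin g → ℂ) : Type :=
  ((Fin g → ℂ) × (Fin m → Additive ℂˣ)) ⧸ T.extLattice r

/-- The projection of an extension to `A`. -/
def Ext.toA {m : ℕ} (r : Fin m → Fin g → ℂ) : T.Ext r → T.A :=
  Quotient.lift (fun x => T.expA x.1) (by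
    intro x y h
    have h' := (QuotientAddGroup.leftRel_apply.1 h).1
    simp only [expA]
    rw [eq_comm, Submodule.Quotient.eq]
    simpa [sub_eq_neg_add] using h')

/-- The projection to `A^*` of an extension of `A^*`. -/
def Ext.toDual {m : ℕ} (r : Fin m → Fin g → ℂ) : T.Ext r → T.Dual :=
  Quotient.lift (fun x => T.expDual (T.polar x.1)) (by
    intro x y h
    have h' := (T.polar_mem_dualLattice_iff _).2 (QuotientAddGroup.leftRel_apply.1 h).1
    simp only [expDual]
    rw [QuotientAddGroup.eq]
    simpa using h')

/-- The map `G → G_{Q_k} = 𝒫|_{A × {Q_k}}`, where `G` is the extension of `A` with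
parameters `r`. -/
def Ext.toPoincare {m : ℕ} (r : Fin m → Fin g → ℂ) (k : Fin m) : T.Ext r → T.Poincare :=
  Quotient.lift (fun x => Quotient.mk T.poincareSetoid ((x.1, r k), (x.2 k).toMul)) (by
    intro x y h
    obtain ⟨h1, h2⟩ := QuotientAddGroup.leftRel_apply.1 h
    refine Quotient.sound ⟨_, h1, 0, zero_mem _, by simp, by simp, ?_⟩
    have h3 := h2 k
    simp only [Prod.snd_add, Prod.snd_neg, Pi.add_apply, Pi.neg_apply, toMul_add, toMul_neg,
      Units.val_mul, Units.val_inv_eq_inv_val] at h3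
    simp only [map_zero, LinearMap.zero_apply, add_zero]
    rw [← h3]
    field_simp)

/-- The map `G^* → G^*_{P_i} = 𝒫|_{{P_i} × A^*}`, where `G^*` is the extension of `A^*` with
parameters `r`. -/
def Ext.toPoincare' {m : ℕ} (r : Fin m → Fin g → ℂ) (i : Fin m) : T.Ext r → T.Poincare :=
  Quotient.lift (fun x => Quotient.mk T.poincareSetoid ((r i, x.1), (x.2 i).toMul)) (by
    intro x y h
    obtain ⟨h1, h2⟩ := QuotientAddGroup.leftRel_apply.1 h
    refine Quotient.sound ⟨0, zero_mem _, _, h1, by simp, by simp, ?_⟩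
    have h3 := h2 i
    simp only [Prod.snd_add, Prod.snd_neg, Pi.add_apply, Pi.neg_apply, toMul_add, toMul_neg,
      Units.val_mul, Units.val_inv_eq_inv_val] at h3
    simp only [map_zero, zero_add, add_zero]
    rw [← h3]
    field_simp)

/-- A theta function whose divisor has first Chern class `H` and does not contain the origin,
normalized by `θ(0) = 1` and `d log θ(0) = 0`. -/
structure Theta where
  toFun : (Fin g → ℂ) → ℂ
  analytic : AnalyticOnNhd ℂ toFun Set.univ
  automorphy : ∀ v ∈ T.lattice, ∃ c : ℂ, ∀ z, toFun (z + v) =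
    c * Complex.exp (Real.pi * T.polar z v + Real.pi / 2 * T.polar v v) * toFun z
  map_zero : toFun 0 = 1
  fderiv_zero : fderiv ℂ toFun 0 = 0

end PPTorus

namespace PPTorus.Theta

variable {g : ℕ} {T : PPTorus g} (Θ : T.Theta)

/-- The functions `h_j` with `d log θ = ∑ h_j dz_j`. -/
def h (j : Fin g) (z : Fin g → ℂ) : ℂ :=
  fderiv ℂ Θ.toFun z (Pi.single j 1) / Θ.toFun z

/-- The function `F_q(z) = θ(z + q) / (θ(z) θ(q)) * exp (- ∑ h_j(q) z_j)`. -/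
def F (q z : Fin g → ℂ) : ℂ :=
  Θ.toFun (z + q) / (Θ.toFun z * Θ.toFun q) * Complex.exp (-∑ j, Θ.h j q * z j)

/-- The exponential map of an extension. On the extension with parameters `r` the function
`(z, w) ↦ w_k θ(z + r_k) / (θ(z) θ(r_k))` is well defined; it is the `k`-th coordinate of
the rational trivialization, and in this coordinate the exponential map is
`(z, t) ↦ exp (t_k) F_{r_k}(z)`. -/
def expExt {m : ℕ} (r : Fin m → Fin g → ℂ) (x : (Fin g → ℂ) × (Fin m → ℂ)) : T.Ext r :=
  QuotientAddGroup.mk (x.1, fun k => Additive.ofMul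
    (Units.mk0 (Complex.exp (x.2 k - ∑ j, Θ.h j (r k) * x.1 j)) (Complex.exp_ne_zero _)))

/-! Differential forms are pulled back to the Lie algebra `ℂ^g × ℂ^m` of the extension
through the exponential map. -/

/-- The form `π^* ω_j = dz_j` of the first kind. -/
def omega (m : ℕ) (j : Fin g) (_ : (Fin g → ℂ) × (Fin m → ℂ)) :
    ((Fin g → ℂ) × (Fin m → ℂ)) →L[ℂ] ℂ :=
  (ContinuousLinearMap.proj j).comp (ContinuousLinearMap.fst ℂ (Fin g → ℂ) (Fin m → ℂ))

/-- The form `π^* η_j = dh_j` of the second kind. -/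
def eta (m : ℕ) (j : Fin g) (x : (Fin g → ℂ) × (Fin m → ℂ)) :
    ((Fin g → ℂ) × (Fin m → ℂ)) →L[ℂ] ℂ :=
  (fderiv ℂ (Θ.h j) x.1).comp (ContinuousLinearMap.fst ℂ (Fin g → ℂ) (Fin m → ℂ))

/-- The form `dt_k`. -/
def dt (g : ℕ) {m : ℕ} (k : Fin m) (_ : (Fin g → ℂ) × (Fin m → ℂ)) :
    ((Fin g → ℂ) × (Fin m → ℂ)) →L[ℂ] ℂ :=
  (ContinuousLinearMap.proj k).comp (ContinuousLinearMap.snd ℂ (Fin g → ℂ) (Fin m → ℂ))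

/-- The form `ξ_q = d log F_q(z)` of the third kind, pulled back from `ℂ^g`. -/
def xi (m : ℕ) (q : Fin g → ℂ) (x : (Fin g → ℂ) × (Fin m → ℂ)) :
    ((Fin g → ℂ) × (Fin m → ℂ)) →L[ℂ] ℂ :=
  ((Θ.F q x.1)⁻¹ • fderiv ℂ (Θ.F q) x.1).comp
    (ContinuousLinearMap.fst ℂ (Fin g → ℂ) (Fin m → ℂ))

/-- The form `ξ̃_k = dZ_k / Z_k`, where `Z_k = exp (t_k) F_{r_k}(z)`. -/
def xiTilde {m : ℕ} (r : Fin m → Fin g → ℂ) (k : Fin m) (x : (Fin g → ℂ) × (Fin m → ℂ)) :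
    ((Fin g → ℂ) × (Fin m → ℂ)) →L[ℂ] ℂ :=
  dt g k x + Θ.xi m (r k) x

/-- The invariant form `ξ^G_k = - ξ̃_k + π^* ξ_{r_k}`. -/
def xiG {m : ℕ} (r : Fin m → Fin g → ℂ) (k : Fin m) (x : (Fin g → ℂ) × (Fin m → ℂ)) :
    ((Fin g → ℂ) × (Fin m → ℂ)) →L[ℂ] ℂ :=
  -Θ.xiTilde r k x + Θ.xi m (r k) x

/-- A `C^1` loop on the extension with parameters `r` above the loop of `A` defined by the
period `v ∈ Λ`, given by a lift to the Lie algebra, which avoids the poles of the forms of the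
second kind. -/
structure Loop {m : ℕ} (r : Fin m → Fin g → ℂ) (v : Fin g → ℂ) where
  source : (Fin g → ℂ) × (Fin m → ℂ)
  target : (Fin g → ℂ) × (Fin m → ℂ)
  path : Path source target
  contDiffOn : ContDiffOn ℝ 1 path.extend (Set.Icc 0 1)
  ne_zero : ∀ s, Θ.toFun (path s).1 ≠ 0
  target_fst : target.1 = source.1 + v
  closed : Θ.expExt r target = Θ.expExt r source

/-- A `C^1` path on the extension with parameters `r` from the origin to the point `R`, given
by a lift to the Lie algebra that joins the origin to a logarithm of `R` above the
logarithm `p` of the projection of `R`, and which avoids the poles of the forms of the second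
kind. -/
structure OpenPath {m : ℕ} (r : Fin m → Fin g → ℂ) (p : Fin g → ℂ) (R : T.Ext r) where
  log : (Fin g → ℂ) × (Fin m → ℂ)
  log_fst : log.1 = p
  exp_log : Θ.expExt r log = R
  path : Path 0 log
  contDiffOn : ContDiffOn ℝ 1 path.extend (Set.Icc 0 1)
  ne_zero : ∀ s, Θ.toFun (path s).1 ≠ 0

/-- `c` is the determination of `∫_z^{z+v} d log F_q = log (F_q(z + v) / F_q(z))` obtained by
continuity, along a deformation of `q` to `0`, from the value `0` for `F_0 = 1`. -/
def IsLogPeriod (q v : Fin g → ℂ) (c : ℂ) : Prop :=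
  ∃ (β : C(I, Fin g → ℂ)) (L : C(I, ℂ)),
    β 0 = 0 ∧ β 1 = q ∧ (∀ u, Θ.toFun (β u) ≠ 0) ∧
    (∀ u z, Θ.F (β u) (z + v) = Complex.exp (L u) * Θ.F (β u) z) ∧
    L 0 = 0 ∧ L 1 = c

/-- `c` is the determination of
`∫_0^p d log F_q - ∫_0^q d log F_p = log (F_q(p) / F_p(q))` obtained by continuity, along a
deformation of `p` and `q` to `0`, from the value `0` for `p = q = 0`. -/
def IsLogRatio (p q : Fin g → ℂ) (c : ℂ) : Prop :=
  ∃ (α β : C(I, Fin g → ℂ)) (L : C(I, ℂ)),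
    α 0 = 0 ∧ β 0 = 0 ∧ α 1 = p ∧ β 1 = q ∧
    (∀ u, Θ.toFun (α u) ≠ 0 ∧ Θ.toFun (β u) ≠ 0) ∧
    (∀ u, u ≠ 1 → Θ.toFun (α u + β u) ≠ 0) ∧
    (∀ u, Θ.F (β u) (α u) = Complex.exp (L u) * Θ.F (α u) (β u)) ∧
    L 0 = 0 ∧ L 1 = c

/-- The normalization `∫_γ ξ̃_k = 0` of the loop `γ`, where
`∫_γ ξ̃_k = ∫_γ dt_k + ∫_γ d log F_{r_k}` and the last, multivalued, integral is taken with its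
continuous determination. -/
def Loop.NormalizedAt {m : ℕ} {r : Fin m → Fin g → ℂ} {v : Fin g → ℂ} (γ : Θ.Loop r v)
    (k : Fin m) : Prop :=
  ∃ c, Θ.IsLogPeriod (r k) v c ∧ curveIntegral (dt g k) γ.path + c = 0

/-- The normalization `∫_ρ ξ̃_k - ∫_{ρ'} ξ̃_i = 0` of a path `ρ` on `G` and a path `ρ'` on `G^*`,
where the difference of the multivalued integrals of `d log F_{q_k}` and `d log F_{p_i}` is
taken with its continuous determination. -/
def OpenPath.CompatibleAt {n s : ℕ} {p : Fin n → Fin g → ℂ} {q : Fin s → Fin g → ℂ}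
    {i : Fin n} {k : Fin s} {R : T.Ext q} {R' : T.Ext p}
    (ρ : Θ.OpenPath q (p i) R) (ρ' : Θ.OpenPath p (q k) R') : Prop :=
  ∃ c, Θ.IsLogRatio (p i) (q k) c ∧
    curveIntegral (dt g k) ρ.path - curveIntegral (dt g i) ρ'.path + c = 0

section Matrices

variable {n s : ℕ} {p : Fin n → Fin g → ℂ} {q : Fin s → Fin g → ℂ}
  {R : Fin n → T.Ext q} {R' : Fin s → T.Ext p}

/-- The base `ω_1, …, ω_g, η_1, …, η_g` of the first de Rham cohomology of `A`. -/
def baseA (m : ℕ) : Fin g ⊕ Fin g → (Fin g → ℂ) × (Fin m → ℂ) →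
    ((Fin g → ℂ) × (Fin m → ℂ)) →L[ℂ] ℂ :=
  Sum.elim (omega m) (Θ.eta m)

/-- The dual base `-η_1, …, -η_g, ω_1, …, ω_g` of the first de Rham cohomology of `A^*`. -/
def baseDual (m : ℕ) : Fin g ⊕ Fin g → (Fin g → ℂ) × (Fin m → ℂ) →
    ((Fin g → ℂ) × (Fin m → ℂ)) →L[ℂ] ℂ :=
  Sum.elim (fun j => -Θ.eta m j) (omega m)

/-- The integral of a form along the `x`-th element of the dual base
`-γ_{g+1}, …, -γ_{2g}, γ_1, …, γ_g`. -/
def dualLoopIntegral {m : ℕ} {r : Fin m → Fin g → ℂ} (γ : ∀ x, Θ.Loop r (T.basis x))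
    (φ : (Fin g → ℂ) × (Fin m → ℂ) → ((Fin g → ℂ) × (Fin m → ℂ)) →L[ℂ] ℂ) :
    Fin g ⊕ Fin g → ℂ :=
  Sum.elim (fun j => -curveIntegral φ (γ (Sum.inr j)).path)
    (fun j => curveIntegral φ (γ (Sum.inl j)).path)

/-- The periods matrix `Π_A`. -/
def PiA (γ : ∀ x, Θ.Loop q (T.basis x)) : Matrix (Fin g ⊕ Fin g) (Fin g ⊕ Fin g) ℂ :=
  Matrix.of fun x y => curveIntegral (Θ.baseA s y) (γ x).path

/-- The periods matrix `Π_{A^*}`. -/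
def PiDual (γ' : ∀ x, Θ.Loop p (T.basis x)) : Matrix (Fin g ⊕ Fin g) (Fin g ⊕ Fin g) ℂ :=
  Matrix.of fun x y => Θ.dualLoopIntegral γ' (Θ.baseDual n y) x

/-- The matrix of generalized logarithms of the points `P_i` of `A`. -/
def logA (ρ : ∀ i, Θ.OpenPath q (p i) (R i)) : Matrix (Fin n) (Fin g ⊕ Fin g) ℂ :=
  Matrix.of fun i y => curveIntegral (Θ.baseA s y) (ρ i).path

/-- The matrix of generalized logarithms of the points `Q_k` of `A^*`: the integrals of the
dual base along the opposite paths. -/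
def logDual (ρ' : ∀ k, Θ.OpenPath p (q k) (R' k)) : Matrix (Fin s) (Fin g ⊕ Fin g) ℂ :=
  Matrix.of fun k y => -curveIntegral (Θ.baseDual n y) (ρ' k).path

/-- The matrix `Υ_Q`. -/
def UpsilonQ (γ : ∀ x, Θ.Loop q (T.basis x)) : Matrix (Fin g ⊕ Fin g) (Fin s) ℂ :=
  Matrix.of fun x k => curveIntegral (Θ.xiG q k) (γ x).path

/-- The matrix `Υ_P`. -/
def UpsilonP (γ' : ∀ x, Θ.Loop p (T.basis x)) : Matrix (Fin g ⊕ Fin g) (Fin n) ℂ :=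
  Matrix.of fun x i => Θ.dualLoopIntegral γ' (Θ.xiG p i) x

/-- The matrix `Ξ_R`. -/
def XiR (ρ : ∀ i, Θ.OpenPath q (p i) (R i)) : Matrix (Fin n) (Fin s) ℂ :=
  Matrix.of fun i k => curveIntegral (Θ.xiG q k) (ρ i).path

/-- The matrix `Ξ_{R^*}`. -/
def XiDual (ρ' : ∀ k, Θ.OpenPath p (q k) (R' k)) : Matrix (Fin s) (Fin n) ℂ :=
  Matrix.of fun k i => -curveIntegral (Θ.xiG p i) (ρ' k).path

end Matrices

end PPTorus.Theta

/-- Two complex matrices are congruent if their difference has entries in `2 i π ℤ`. -/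
def Matrix.CongrTwoPiI {a b : Type*} (X Y : Matrix a b ℂ) : Prop :=
  ∀ i j, ∃ m : ℤ, X i j = Y i j + 2 * Real.pi * Complex.I * m

end

noncomputable section

/-! ### Continuous logarithms and logarithmic derivatives on the unit interval -/

/-! On the Lie algebra the two copies of `d log F` in `ξ^G_k` cancel, so `ξ^G_k = -dt_k` and the
left-hand sides only record differences of `t`-coordinates. The right-hand sides are equally
explicit: along a loop above `v` the form `ω_j` integrates to `v_j` and `η_j` to `π H(e_j, v)`,
while along an open path to `p` they integrate to `p_j` and `h_j(p)`, because `d log θ(0) = 0`.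
Multiplying the matrices gives the numbers `period q v = π H(q, v) - d log θ(q)(v)` and `logRatio p
q = d log θ(p)(q) - d log θ(q)(p)`, up to sign in the rows of the dual base.

These numbers are exponents attached to `F`. The functional equation of `θ` gives `F_q(z + v) = exp
(period q v) F_q(z)` (`F_add`), and the symmetry of `θ(p + q) / (θ(p) θ(q))` gives `F_q(p) = exp
(logRatio p q) F_p(q)` (`F_eq_exp_mul_F`). Closing a loop on an extension forces `Δt_k + period`
into `2πiℤ`. Two points of `G` and `G^*` with the same image in the Poincaré torsor satisfy the
analogous condition with `logRatio`. This yields the three congruences.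

Exact equality is a choice of branch. Both exponents are continuous in the deformed points as long
as these avoid the zeros of `θ`, and they vanish at the origin, so they are the only continuous
determinations (`isLogPeriod_iff`, `isLogRatio_iff`). Each normalization then says precisely that
the integer is zero. The same uniqueness argument compares them with the actual integrals of `d log
F`. Deformations exist because `θ` has countably many zeros on a complex line through the origin, so
some arc in that line misses them. -/

theorem eq_zero_of_continuous_of_exp_eq_one {L : I → ℂ} (hL : Continuous L) (h0 : L 0 = 0)
    (h : ∀ u, Complex.exp (L u) = 1) (u : I) : L u = 0 := by
  -- `L` takes values in `2πiℤ`, where zero is the only element of norm less than one; hence the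
  -- closed set `L = 0` is also open in the connected interval.
  have key : ∀ u, L u = 0 ↔ ‖L u‖ < 1 := by
    refine fun u => ⟨fun hu => by simp [hu], fun hu => ?_⟩
    obtain ⟨n, hn⟩ := Complex.exp_eq_one_iff.1 (h u)
    rcases eq_or_ne n 0 with rfl | hne
    · simpa using hn
    · exfalso
      rw [hn] at hu
      simp only [norm_mul, Complex.norm_intCast, Complex.norm_ofNat, Complex.norm_real,
        Complex.norm_I, Real.norm_eq_abs, abs_of_pos Real.pi_pos, mul_one] at hu
      have h1 : (1 : ℝ) ≤ |(n : ℝ)| := by exact_mod_cast Int.one_le_abs hne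
      nlinarith [Real.pi_gt_three]
  have hclopen : IsClopen {u | L u = 0} := by
    refine ⟨isClosed_eq hL continuous_const, ?_⟩
    simp only [key]
    exact isOpen_lt hL.norm continuous_const
  have := hclopen.eq_univ ⟨0, h0⟩
  exact Set.eq_univ_iff_forall.1 this u

theorem eq_of_continuous_of_exp_eq_exp {L K : I → ℂ} (hL : Continuous L) (hK : Continuous K)
    (h0 : L 0 = K 0) (h : ∀ u, Complex.exp (L u) = Complex.exp (K u)) (u : I) : L u = K u :=
  sub_eq_zero.1 <| eq_zero_of_continuous_of_exp_eq_one (L := fun u => L u - K u) (hL.sub hK)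
    (by simp [h0]) (fun u => by rw [Complex.exp_sub, h, div_self (Complex.exp_ne_zero _)]) u

section LogDeriv

variable {a : ℝ → ℂ} (ha : ContDiffOn ℝ 1 a I) (h0 : ∀ t ∈ I, a t ≠ 0)
include ha h0

theorem continuousOn_derivWithin_div :
    ContinuousOn (fun t => derivWithin a I t / a t) I :=
  (ha.continuousOn_derivWithin uniqueDiffOn_Icc_zero_one le_rfl).div ha.continuousOn h0

theorem continuous_integral_derivWithin_div :
    Continuous fun u : I => ∫ t in (0 : ℝ)..u, derivWithin a I t / a t := by
  have hg := (continuousOn_derivWithin_div ha h0).domRestrict.Icc_extend' (h := zero_le_one)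
  have := (intervalIntegral.continuous_primitive (μ := MeasureTheory.volume)
    (fun x y => hg.intervalIntegrable x y) 0).comp (continuous_subtype_val (p := (· ∈ I)))
  refine this.congr fun u => intervalIntegral.integral_congr fun t ht => ?_
  rw [Set.uIcc_of_le u.2.1] at ht
  exact Set.IccExtend_of_mem zero_le_one _ ⟨ht.1, ht.2.trans u.2.2⟩

/-- The product `exp (-∫ a'/a) * a` has zero derivative, so the integral is the logarithm of `a u /
a 0` followed continuously from `0`. -/
theorem exp_integral_derivWithin_div (u : I) :
    Complex.exp (∫ t in (0 : ℝ)..u, derivWithin a I t / a t) * a 0 = a u := by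
  -- Extending by constants makes the integrand continuous on `ℝ`, so that its primitive is
  -- differentiable at the endpoints too.
  set g := Set.IccExtend (zero_le_one' ℝ) (Set.domRestrict I fun t => derivWithin a I t / a t)
  have hg : Continuous g :=
    (continuousOn_derivWithin_div ha h0).domRestrict.Icc_extend' (h := zero_le_one)
  have hgeq : ∀ t ∈ I, g t = derivWithin a I t / a t := fun t ht =>
    Set.IccExtend_of_mem zero_le_one _ ht
  have hD : ∀ t ∈ I, HasDerivWithinAt
      (fun τ => Complex.exp (-∫ t in (0 : ℝ)..τ, g t) * a τ) 0 I t := by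
    intro t ht
    have h1 : HasDerivAt (fun τ => ∫ t in (0 : ℝ)..τ, g t) (g t) t :=
      (hg.integral_hasStrictDerivAt 0 t).hasDerivAt
    have h2 := (ha.differentiableOn one_ne_zero t ht).hasDerivWithinAt
    have h3 := (h1.neg.cexp.hasDerivWithinAt (s := I)).mul h2
    convert! h3 using 1
    rw [hgeq t ht]
    have := h0 t ht
    simp only [Pi.neg_apply]
    field_simp
    ring
  have hconst := constant_of_derivWithin_zero
    (fun t ht => (hD t ht).differentiableWithinAt)
    (fun t ht => (hD t ⟨ht.1, ht.2.le⟩).derivWithin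
      (uniqueDiffOn_Icc_zero_one t ⟨ht.1, ht.2.le⟩)) u u.2
  have hint : ∫ t in (0 : ℝ)..u, derivWithin a I t / a t = ∫ t in (0 : ℝ)..u, g t := by
    refine intervalIntegral.integral_congr fun t ht => ?_
    rw [Set.uIcc_of_le u.2.1] at ht
    exact (hgeq t ⟨ht.1, ht.2.trans u.2.2⟩).symm
  simp only [intervalIntegral.integral_same, neg_zero, Complex.exp_zero, one_mul] at hconst
  rw [hint, ← hconst, ← mul_assoc, ← Complex.exp_add]
  simp

end LogDeriv

theorem continuous_intervalIntegral_of_continuousOn_prod {f : I → ℝ → ℂ}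
    (hf : ContinuousOn (Function.uncurry f) (Set.univ ×ˢ I)) :
    Continuous fun u => ∫ t in (0 : ℝ)..1, f u t := by
  have h1 : Continuous (Function.uncurry fun (u : I) (t : ℝ) =>
      f u (Set.projIcc 0 1 zero_le_one t)) :=
    hf.comp_continuous (f := fun x : I × ℝ => (x.1, (Set.projIcc 0 1 zero_le_one x.2 : ℝ)))
      (by fun_prop) fun x => ⟨trivial, Subtype.coe_prop _⟩
  refine (intervalIntegral.continuous_parametric_intervalIntegral_of_continuous'
    (μ := MeasureTheory.volume) h1 0 1).congr fun u =>
      intervalIntegral.integral_congr fun t ht => ?_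
  rw [Set.uIcc_of_le zero_le_one] at ht
  simp [Set.projIcc_of_mem zero_le_one ht]

/-! ### Curve integrals of exact forms -/

section CurveIntegral

variable {E : Type*} [NormedAddCommGroup E] [NormedSpace ℂ E] {x y : E} {γ : Path x y}

theorem curveIntegral_eq_sub_of_hasFDerivAt {f : E → ℂ} {ω : E → E →L[ℂ] ℂ}
    (hγ : ContDiffOn ℝ 1 γ.extend I) (hω : ContinuousOn ω (Set.range γ))
    (hf : ∀ t, HasFDerivAt f (ω (γ t)) (γ t)) : curveIntegral ω γ = f y - f x := by
  have hint : CurveIntegrable ω γ :=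
    hω.curveIntegrable_of_contDiffOn hγ (fun t => ⟨t, rfl⟩)
  have hd : ∀ t ∈ I, HasDerivWithinAt (f ∘ γ.extend) (curveIntegralFun ω γ t) I t := by
    intro t ht
    rw [curveIntegralFun_def]
    have h := hf ⟨t, ht⟩
    rw [← γ.extend_apply ht] at h
    exact (h.restrictScalars ℝ).comp_hasDerivWithinAt t
      (hγ.differentiableOn one_ne_zero t ht).hasDerivWithinAt
  rw [curveIntegral_def, intervalIntegral.integral_eq_sub_of_hasDerivAt_of_le zero_le_one
    (fun t ht => (hd t ht).continuousWithinAt)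
    (fun t ht => (hd t ⟨ht.1.le, ht.2.le⟩).hasDerivAt (Icc_mem_nhds ht.1 ht.2)) hint]
  simp

theorem curveIntegral_const_clm (hγ : ContDiffOn ℝ 1 γ.extend I) (l : E →L[ℂ] ℂ) :
    curveIntegral (fun _ => l) γ = l y - l x :=
  curveIntegral_eq_sub_of_hasFDerivAt hγ continuousOn_const fun _ => l.hasFDerivAt

end CurveIntegral

/-! ### Arcs that avoid a countable set -/

/-- An arc from `0` to `1` in the complex plane. -/
def arc (s t : ℝ) : ℂ := t + s * (t * (1 - t)) * Complex.I

@[simp] theorem arc_zero (s : ℝ) : arc s 0 = 0 := by simp [arc]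

@[simp] theorem arc_one (s : ℝ) : arc s 1 = 1 := by simp [arc]

theorem contDiff_arc (s : ℝ) : ContDiff ℝ 1 (arc s) := by
  have : ContDiff ℝ 1 (fun t : ℝ => (t : ℂ)) := Complex.ofRealCLM.contDiff
  unfold arc
  fun_prop

/-- Away from its endpoints an arc determines `s` as `im / (re (1 - re))`. So `Z` excludes only
countably many values of `s`. -/
theorem exists_arc_notMem {Z : Set ℂ} (hZ : Z.Countable) :
    ∃ s : ℝ, ∀ t : ℝ, t ≠ 0 → t ≠ 1 → arc s t ∉ Z := by
  have hc : ((fun z : ℂ => z.im / (z.re * (1 - z.re))) '' Z).Countable := hZ.image _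
  obtain ⟨s, hs⟩ : ∃ s, s ∉ (fun z : ℂ => z.im / (z.re * (1 - z.re))) '' Z := by
    by_contra! h
    exact Cardinal.not_countable_real ((Set.eq_univ_of_forall h) ▸ hc)
  refine ⟨s, fun t h0 h1 hmem => hs ⟨_, hmem, ?_⟩⟩
  have hre : (arc s t).re = t := by simp [arc]
  have him : (arc s t).im = s * (t * (1 - t)) := by simp [arc]
  have : 1 - t ≠ 0 := sub_ne_zero.2 (Ne.symm h1)
  simp only [hre, him]
  field_simp

/-- Since `f` is not identically zero its zeros are isolated, and a discrete subset of the
hereditarily Lindelöf plane is countable. -/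
theorem AnalyticOnNhd.countable_zeros {f : ℂ → ℂ} (hf : AnalyticOnNhd ℂ f Set.univ)
    {x : ℂ} (hx : f x ≠ 0) : {z | f z = 0}.Countable := by
  have h := AnalyticOnNhd.preimage_zero_mem_codiscrete hf hx
  have h' : IsDiscrete ({z | f z = 0} ∩ Set.univ) := isDiscrete_of_codiscreteWithin h
  rw [Set.inter_univ] at h'
  exact (HereditarilyLindelofSpace.isLindelof _).countable_of_isDiscrete h'

namespace PPTorus.Theta

variable {g : ℕ} {T : PPTorus g} (Θ : T.Theta)

/-! ### The logarithmic differential of `θ` -/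

/-- The logarithmic differential `d log θ`. -/
def dlog (z : Fin g → ℂ) : (Fin g → ℂ) →L[ℂ] ℂ := (Θ.toFun z)⁻¹ • fderiv ℂ Θ.toFun z

theorem h_eq_dlog (j : Fin g) (z : Fin g → ℂ) : Θ.h j z = Θ.dlog z (Pi.single j 1) := by
  simp [h, dlog, div_eq_inv_mul]

theorem apply_eq_sum_mul_single {F : Type*} [FunLike F (Fin g → ℂ) ℂ]
    [LinearMapClass F ℂ (Fin g → ℂ) ℂ] (l : F) (w : Fin g → ℂ) :
    l w = ∑ j, l (Pi.single j 1) * w j := by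
  conv_lhs => rw [pi_eq_sum_univ' w]
  rw [map_sum]
  refine Finset.sum_congr rfl fun j _ => ?_
  rw [map_smul, smul_eq_mul, mul_comm]

theorem sum_h_mul (q w : Fin g → ℂ) : ∑ j, Θ.h j q * w j = Θ.dlog q w := by
  simp only [h_eq_dlog]
  exact (apply_eq_sum_mul_single (Θ.dlog q) w).symm

theorem F_eq (q z : Fin g → ℂ) : Θ.F q z =
    Θ.toFun (z + q) / (Θ.toFun z * Θ.toFun q) * Complex.exp (-Θ.dlog q z) := by
  rw [F, sum_h_mul]

theorem differentiable : Differentiable ℂ Θ.toFun := fun z =>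
  (Θ.analytic z trivial).differentiableAt

theorem continuous : Continuous Θ.toFun := Θ.differentiable.continuous

@[simp] theorem dlog_zero : Θ.dlog 0 = 0 := by
  ext w
  change (Θ.toFun 0)⁻¹ • fderiv ℂ Θ.toFun 0 _ = 0
  rw [Θ.fderiv_zero]
  exact mul_zero _

theorem continuousOn_dlog : ContinuousOn Θ.dlog {z | Θ.toFun z ≠ 0} :=
  (Θ.continuous.continuousOn.inv₀ fun _ hz => hz).smul
    (Θ.analytic.fderiv.continuousOn.mono (Set.subset_univ _))

theorem analyticAt_h (j : Fin g) {z : Fin g → ℂ} (hz : Θ.toFun z ≠ 0) :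
    AnalyticAt ℂ (Θ.h j) z := by
  have h1 : AnalyticAt ℂ (fderiv ℂ Θ.toFun) z := (Θ.analytic z trivial).fderiv
  have h2 : AnalyticAt ℂ (fun z => fderiv ℂ Θ.toFun z (Pi.single j 1)) z :=
    ((ContinuousLinearMap.apply ℂ ℂ (Pi.single j 1 : Fin g → ℂ)).analyticAt _).comp h1
  exact h2.div (Θ.analytic z trivial) hz

theorem automorphy_ne_zero {v : Fin g → ℂ} (hv : v ∈ T.lattice) : ∃ c : ℂ, c ≠ 0 ∧ ∀ z,
    Θ.toFun (z + v) = c * Complex.exp (Real.pi * T.polar z v + Real.pi / 2 * T.polar v v)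
      * Θ.toFun z := by
  obtain ⟨c, hc⟩ := Θ.automorphy v hv
  refine ⟨c, ?_, hc⟩
  rintro rfl
  have := hc (-v)
  simp [Θ.map_zero] at this

theorem ne_zero_add_iff {v : Fin g → ℂ} (hv : v ∈ T.lattice) (z : Fin g → ℂ) :
    Θ.toFun (z + v) ≠ 0 ↔ Θ.toFun z ≠ 0 := by
  obtain ⟨c, hc0, hc⟩ := Θ.automorphy_ne_zero hv
  rw [hc z]
  simp [hc0, Complex.exp_ne_zero]

/-- Logarithmic differentiation of the functional equation: the exponent is affine in `z`, with
ℂ-linear part `π H(·, v)`. -/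
theorem dlog_add {v : Fin g → ℂ} (hv : v ∈ T.lattice) {z : Fin g → ℂ} (hz : Θ.toFun z ≠ 0)
    (w : Fin g → ℂ) : Θ.dlog (z + v) w = Θ.dlog z w + Real.pi * T.polar w v := by
  obtain ⟨c, hc0, hc⟩ := Θ.automorphy_ne_zero hv
  let l : (Fin g → ℂ) →L[ℂ] ℂ := LinearMap.toContinuousLinearMap
    { toFun := fun z => (Real.pi : ℂ) * T.polar z v
      map_add' := fun a b => by simp [mul_add]
      map_smul' := fun a b => by simp; ring }
  have hl : ∀ z, l z = Real.pi * T.polar z v := fun z => rfl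
  have hfun : (fun z => Θ.toFun (z + v)) = fun z =>
      c * Complex.exp (l z + Real.pi / 2 * T.polar v v) * Θ.toFun z := funext hc
  have h1 : HasFDerivAt (fun z => Θ.toFun (z + v)) (fderiv ℂ Θ.toFun (z + v)) z :=
    (hasFDerivAt_comp_add_right v).2 (Θ.differentiable (z + v)).hasFDerivAt
  have h2 := (((l.hasFDerivAt (x := z)).add_const (Real.pi / 2 * T.polar v v)).cexp.const_mul
    c).mul (Θ.differentiable z).hasFDerivAt
  rw [hfun] at h1
  have h3 := congrArg (fun L => L w) (h1.unique h2)
  simp only [add_apply, smul_apply, smul_eq_mul] at h3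
  simp only [dlog, smul_apply, smul_eq_mul, h3]
  rw [hc z, ← hl z, ← hl w]
  have := Complex.exp_ne_zero (l z + Real.pi / 2 * T.polar v v)
  field_simp

theorem h_add {v : Fin g → ℂ} (hv : v ∈ T.lattice) {z : Fin g → ℂ} (hz : Θ.toFun z ≠ 0)
    (j : Fin g) : Θ.h j (z + v) - Θ.h j z = Real.pi * T.polar (Pi.single j 1) v := by
  rw [h_eq_dlog, h_eq_dlog, Θ.dlog_add hv hz]
  ring

@[simp] theorem h_zero (j : Fin g) : Θ.h j 0 = 0 := by simp [h_eq_dlog]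

/-! ### The functions `F_q` -/

/-- The exponent of the multiplier of `F_q` for the period `v`. -/
def period (q v : Fin g → ℂ) : ℂ := Real.pi * T.polar q v - Θ.dlog q v

/-- The exponent of `F_q(p) / F_p(q)`. -/
def logRatio (p q : Fin g → ℂ) : ℂ := Θ.dlog p q - Θ.dlog q p

/-- In `θ(z + q) / θ(z)` the constants and the factors depending on `z` cancel, leaving `exp (π H(q,
v))`; the exponential in `F_q` contributes the rest. -/
theorem F_add {v : Fin g → ℂ} (hv : v ∈ T.lattice) (q z : Fin g → ℂ) :
    Θ.F q (z + v) = Complex.exp (Θ.period q v) * Θ.F q z := by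
  obtain ⟨c, hc0, hc⟩ := Θ.automorphy_ne_zero hv
  rw [F_eq, F_eq, add_right_comm, hc, hc, period]
  -- At a zero of `θ` division by zero makes both sides vanish, so no hypothesis on `z` or `q` is
  -- needed.
  by_cases hz : Θ.toFun z = 0
  · simp [hz]
  by_cases hq : Θ.toFun q = 0
  · simp [hq]
  have e1 : Real.pi * T.polar (z + q) v + Real.pi / 2 * T.polar v v = Real.pi * T.polar q v
      + (Real.pi * T.polar z v + Real.pi / 2 * T.polar v v) := by
    simp only [map_add, LinearMap.add_apply]; ring
  rw [e1, Complex.exp_add (Real.pi * T.polar q v), map_add, neg_add, Complex.exp_add (-Θ.dlog q z), sub_eq_add_neg,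
    Complex.exp_add (Real.pi * T.polar q v)]
  have := Complex.exp_ne_zero (Real.pi * T.polar z v + Real.pi / 2 * T.polar v v)
  field_simp

theorem F_apply_zero {q : Fin g → ℂ} (hq : Θ.toFun q ≠ 0) : Θ.F q 0 = 1 := by
  simp [F_eq, Θ.map_zero, hq]

theorem F_ne_zero {q z : Fin g → ℂ} (hq : Θ.toFun q ≠ 0) (hz : Θ.toFun z ≠ 0)
    (hzq : Θ.toFun (z + q) ≠ 0) : Θ.F q z ≠ 0 := by
  rw [F_eq]
  exact mul_ne_zero (div_ne_zero hzq (mul_ne_zero hz hq)) (Complex.exp_ne_zero _)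

theorem F_eq_exp_mul_F (p q : Fin g → ℂ) :
    Θ.F q p = Complex.exp (Θ.logRatio p q) * Θ.F p q := by
  rw [F_eq, F_eq, logRatio, sub_eq_add_neg, Complex.exp_add, add_comm q p,
    mul_comm (Θ.toFun q), Complex.exp_neg (Θ.dlog p q)]
  have := Complex.exp_ne_zero (Θ.dlog p q)
  field_simp

theorem hasFDerivAt_F {q z : Fin g → ℂ} (hq : Θ.toFun q ≠ 0) (hz : Θ.toFun z ≠ 0)
    (hzq : Θ.toFun (z + q) ≠ 0) :
    HasFDerivAt (Θ.F q) (Θ.F q z • (Θ.dlog (z + q) - Θ.dlog z - Θ.dlog q)) z := by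
  have h1 : HasFDerivAt (fun z => Θ.toFun (z + q)) (fderiv ℂ Θ.toFun (z + q)) z :=
    (hasFDerivAt_comp_add_right q).2 (Θ.differentiable (z + q)).hasFDerivAt
  have h2 := (Θ.differentiable z).hasFDerivAt.mul_const (Θ.toFun q)
  have h3 := ((Θ.dlog q).hasFDerivAt (x := z)).neg.cexp
  have h4 := (h1.mul ((hasDerivAt_inv (mul_ne_zero hz hq)).comp_hasFDerivAt z h2)).mul h3
  have hfun : Θ.F q = fun z => Θ.toFun (z + q) * (Θ.toFun z * Θ.toFun q)⁻¹ *
      Complex.exp (-Θ.dlog q z) := funext fun z => by rw [F_eq, div_eq_mul_inv]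
  rw [hfun]
  refine h4.congr_fderiv ?_
  ext w
  simp only [dlog, Pi.mul_apply, add_apply, smul_apply, smul_eq_mul,
    sub_apply, neg_apply, Pi.neg_apply,
    Function.comp_apply]
  field_simp
  ring

theorem inv_F_smul_fderiv_F {q z : Fin g → ℂ} (hq : Θ.toFun q ≠ 0) (hz : Θ.toFun z ≠ 0)
    (hzq : Θ.toFun (z + q) ≠ 0) :
    (Θ.F q z)⁻¹ • fderiv ℂ (Θ.F q) z = Θ.dlog (z + q) - Θ.dlog z - Θ.dlog q := by
  rw [(Θ.hasFDerivAt_F hq hz hzq).fderiv, inv_smul_smul₀ (Θ.F_ne_zero hq hz hzq)]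

/-! ### Arcs outside the zeros of `θ` -/

theorem countable_zeros_line (w : Fin g → ℂ) : {z : ℂ | Θ.toFun (z • w) = 0}.Countable := by
  have h : AnalyticOnNhd ℂ (fun z : ℂ => Θ.toFun (z • w)) Set.univ := fun z _ => by
    have h1 : AnalyticAt ℂ (fun z : ℂ => z • w) z :=
      ((ContinuousLinearMap.toSpanSingleton ℂ w).analyticAt z)
    exact AnalyticAt.fun_comp (f := fun z : ℂ => z • w) (Θ.analytic (z • w) trivial) h1
  exact h.countable_zeros (x := 0) (by simp [Θ.map_zero])

theorem exists_arc_ne_zero {w : Fin g → ℂ} (hw : Θ.toFun w ≠ 0) :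
    ∃ s : ℝ, ∀ t : ℝ, Θ.toFun (arc s t • w) ≠ 0 := by
  obtain ⟨s, hs⟩ := exists_arc_notMem (Θ.countable_zeros_line w)
  refine ⟨s, fun t => ?_⟩
  rcases eq_or_ne t 0 with rfl | h0
  · simp [Θ.map_zero]
  rcases eq_or_ne t 1 with rfl | h1
  · simpa using hw
  exact hs t h0 h1

theorem continuous_arc (s : ℝ) : Continuous (arc s) := (contDiff_arc s).continuous

/-! ### The continuous determinations -/

theorem continuous_dlog_comp {X : Type*} [TopologicalSpace X] {β : X → Fin g → ℂ}
    (hβ : Continuous β) (h : ∀ u, Θ.toFun (β u) ≠ 0) : Continuous fun u => Θ.dlog (β u) :=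
  Θ.continuousOn_dlog.comp_continuous hβ h

theorem continuous_polar_left (v : Fin g → ℂ) : Continuous fun z => T.polar z v := by
  simpa using! (LinearMap.toContinuousLinearMap (T.polar.flip v)).continuous

theorem continuous_period_comp {X : Type*} [TopologicalSpace X] {β : X → Fin g → ℂ}
    (hβ : Continuous β) (h : ∀ u, Θ.toFun (β u) ≠ 0) (v : Fin g → ℂ) :
    Continuous fun u => Θ.period (β u) v :=
  (continuous_const.mul ((continuous_polar_left v).comp hβ)).sub
    ((Θ.continuous_dlog_comp hβ h).clm_apply continuous_const)

theorem continuous_logRatio_comp {X : Type*} [TopologicalSpace X] {α β : X → Fin g → ℂ}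
    (hα : Continuous α) (hβ : Continuous β) (h : ∀ u, Θ.toFun (α u) ≠ 0)
    (h' : ∀ u, Θ.toFun (β u) ≠ 0) : Continuous fun u => Θ.logRatio (α u) (β u) :=
  ((Θ.continuous_dlog_comp hα h).clm_apply hβ).sub ((Θ.continuous_dlog_comp hβ h').clm_apply hα)

@[simp] theorem period_zero (v : Fin g → ℂ) : Θ.period 0 v = 0 := by simp [period]

@[simp] theorem logRatio_zero_right (p : Fin g → ℂ) : Θ.logRatio p 0 = 0 := by simp [logRatio]

/-- Along any admissible deformation `L` and `period` are continuous logarithms of the same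
multiplier with value `0` at the start, so they coincide; an arc in the line through `q` shows that
a deformation exists. -/
theorem isLogPeriod_iff {q v : Fin g → ℂ} (hv : v ∈ T.lattice) (hq : Θ.toFun q ≠ 0) (c : ℂ) :
    Θ.IsLogPeriod q v c ↔ c = Θ.period q v := by
  constructor
  · rintro ⟨β, L, hβ0, rfl, hβ, hF, hL0, rfl⟩
    refine eq_of_continuous_of_exp_eq_exp L.continuous (Θ.continuous_period_comp β.continuous hβ v)
      (by simp [hL0, hβ0]) (fun u => ?_) 1
    have h := hF u 0
    rwa [Θ.F_add hv, Θ.F_apply_zero (hβ u), mul_one, mul_one, eq_comm] at h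
  · rintro rfl
    obtain ⟨s, hs⟩ := Θ.exists_arc_ne_zero hq
    have hc : Continuous fun u : I => arc s u • q := by
      have := continuous_arc s
      fun_prop
    exact ⟨⟨_, hc⟩, ⟨_, Θ.continuous_period_comp hc (fun u => hs u) v⟩, by simp, by simp,
      fun u => hs u, fun u z => Θ.F_add hv _ z, by simp, by simp⟩

theorem isLogRatio_iff {p q : Fin g → ℂ} (hp : Θ.toFun p ≠ 0) (hq : Θ.toFun q ≠ 0) (c : ℂ) :
    Θ.IsLogRatio p q c ↔ c = Θ.logRatio p q := by
  constructor
  · rintro ⟨α, β, L, hα0, hβ0, rfl, rfl, hαβ, hsum, hF, hL0, rfl⟩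
    have hc := Θ.continuous_logRatio_comp α.continuous β.continuous (fun u => (hαβ u).1)
      (fun u => (hαβ u).2)
    refine eq_of_continuous_of_exp_eq_exp L.continuous hc (by simp [hL0, hα0, hβ0]) ?_ 1
    -- The sum `p + q` may be a zero of `θ`, and then `F_p(q) = 0` cannot be cancelled at `u = 1`.
    -- The exponentials are compared for `u ≠ 1` and the equality extends by density.
    refine congrFun ((Continuous.ext_on (dense_compl_singleton (1 : I))
      L.continuous.cexp hc.cexp) fun u hu => ?_)
    have h := hF u
    rw [Θ.F_eq_exp_mul_F] at h
    refine (mul_right_cancel₀ (Θ.F_ne_zero (hαβ u).1 (hαβ u).2 ?_) h).symm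
    rw [add_comm]
    exact hsum u hu
  · rintro rfl
    -- One parameter `s` avoids the zeros on the lines through `p`, `q` and `p + q` at once, except
    -- possibly at the endpoint of the last one.
    obtain ⟨s, hs⟩ := exists_arc_notMem (((Θ.countable_zeros_line p).union
      (Θ.countable_zeros_line q)).union (Θ.countable_zeros_line (p + q)))
    simp only [Set.mem_union, Set.mem_ofPred_eq, not_or] at hs
    have hne : ∀ u : I, Θ.toFun (arc s u • p) ≠ 0 ∧ Θ.toFun (arc s u • q) ≠ 0 := by
      intro u
      rcases eq_or_ne (u : ℝ) 0 with h0 | h0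
      · simp [h0, Θ.map_zero]
      rcases eq_or_ne (u : ℝ) 1 with h1 | h1
      · simp [h1, hp, hq]
      exact (hs u h0 h1).1
    have hc : ∀ w : Fin g → ℂ, Continuous fun u : I => arc s u • w := by
      have := continuous_arc s
      fun_prop
    refine ⟨⟨_, hc p⟩, ⟨_, hc q⟩, ⟨_, Θ.continuous_logRatio_comp (hc p) (hc q)
      (fun u => (hne u).1) (fun u => (hne u).2)⟩, by simp, by simp, by simp, by simp, hne, ?_,
      fun u => Θ.F_eq_exp_mul_F _ _, by simp, by simp⟩
    intro u hu
    simp only [ContinuousMap.coe_mk, ← smul_add]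
    rcases eq_or_ne (u : ℝ) 0 with h0 | h0
    · simp [h0, Θ.map_zero]
    · exact (hs u h0 fun h => hu (Subtype.ext h)).2

/-- Translation by a period `v` together with `Δt_k` multiplies `Z_k = exp (t_k) F_{r_k}(z)` by `exp
(Δt_k + period)`, and the two points agree on the extension exactly when all these factors are `1`.
-/
theorem expExt_eq_iff {m : ℕ} (r : Fin m → Fin g → ℂ) {x y : (Fin g → ℂ) × (Fin m → ℂ)}
    (h : y.1 - x.1 ∈ T.lattice) : Θ.expExt r x = Θ.expExt r y ↔
      ∀ k, ∃ n : ℤ, y.2 k - x.2 k + Θ.period (r k) (y.1 - x.1) = n * (2 * Real.pi * Complex.I) := by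
  rw [expExt, expExt, QuotientAddGroup.eq]
  have key : ∀ k, (Complex.exp (x.2 k - ∑ j, Θ.h j (r k) * x.1 j))⁻¹ *
      Complex.exp (y.2 k - ∑ j, Θ.h j (r k) * y.1 j) =
        Complex.exp (-(Real.pi * T.polar (r k) (-x.1 + y.1))) ↔
      ∃ n : ℤ, y.2 k - x.2 k + Θ.period (r k) (y.1 - x.1) = n * (2 * Real.pi * Complex.I) := by
    intro k
    rw [← Complex.exp_neg, ← Complex.exp_add, ← sub_eq_zero, ← Complex.exp_eq_one_iff,
      sub_eq_zero, ← div_eq_one_iff_eq (Complex.exp_ne_zero _), ← Complex.exp_sub, sum_h_mul,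
      sum_h_mul, period]
    simp only [map_sub, map_add, map_neg]
    ring_nf
  have h' : -x.1 + y.1 ∈ T.lattice := by rwa [neg_add_eq_sub]
  exact (and_iff_right h').trans (forall_congr' key)

/-! ### Integrals along paths in the Lie algebra -/

section Integrals

variable {m : ℕ} {x y : (Fin g → ℂ) × (Fin m → ℂ)} {γ : Path x y}

/-- The two terms `d log F` cancel at every point, including the poles, where they have default
values. -/
theorem xiG_eq_neg_dt (r : Fin m → Fin g → ℂ) (k : Fin m) : Θ.xiG r k = -dt g k := by
  funext x
  simp [xiG, xiTilde]

theorem xiTilde_eq_dt_add_xi (r : Fin m → Fin g → ℂ) (k : Fin m) :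
    Θ.xiTilde r k = dt g k + Θ.xi m (r k) := rfl

section

variable (hγ : ContDiffOn ℝ 1 γ.extend I)
include hγ

theorem curveIntegral_dt (k : Fin m) : curveIntegral (dt g k) γ = y.2 k - x.2 k :=
  curveIntegral_const_clm hγ _

theorem curveIntegral_omega (j : Fin g) : curveIntegral (omega m j) γ = y.1 j - x.1 j :=
  curveIntegral_const_clm hγ _

theorem curveIntegral_xiG (r : Fin m → Fin g → ℂ) (k : Fin m) :
    curveIntegral (Θ.xiG r k) γ = -(y.2 k - x.2 k) := by
  rw [xiG_eq_neg_dt, curveIntegral_neg, curveIntegral_dt hγ]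

variable (h0 : ∀ s, Θ.toFun (γ s).1 ≠ 0)
include h0

theorem curveIntegral_eta (j : Fin g) :
    curveIntegral (Θ.eta m j) γ = Θ.h j y.1 - Θ.h j x.1 := by
  refine curveIntegral_eq_sub_of_hasFDerivAt (f := fun z => Θ.h j z.1) hγ ?_ fun t => ?_
  · rintro _ ⟨t, rfl⟩
    have h1 : ContinuousAt (fderiv ℂ (Θ.h j)) (γ t).1 := (Θ.analyticAt_h j (h0 t)).fderiv.continuousAt
    have h2 : ContinuousAt (fun z : (Fin g → ℂ) × (Fin m → ℂ) => fderiv ℂ (Θ.h j) z.1) (γ t) :=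
      ContinuousAt.comp (f := Prod.fst) h1 continuousAt_fst
    exact (h2.clm_comp continuousAt_const).continuousWithinAt
  · exact (Θ.analyticAt_h j (h0 t)).differentiableAt.hasFDerivAt.comp (γ t) hasFDerivAt_fst

section

variable {q : Fin g → ℂ} (hq : Θ.toFun q ≠ 0) (hsum : ∀ s, Θ.toFun ((γ s).1 + q) ≠ 0)
include hq hsum

omit hγ in
theorem F_extend_ne_zero : ∀ t ∈ I, Θ.F q (γ.extend t).1 ≠ 0 := fun t ht => by
  rw [γ.extend_apply ht]
  exact Θ.F_ne_zero hq (h0 _) (hsum _)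

omit hsum in
theorem contDiffOn_F_extend : ContDiffOn ℝ 1 (fun t => Θ.F q (γ.extend t).1) I := by
  intro t ht
  have hF : AnalyticAt ℂ (Θ.F q) (γ.extend t).1 := by
    rw [γ.extend_apply ht]
    have h1 : AnalyticAt ℂ (fun z => Θ.toFun (z + q)) (γ ⟨t, ht⟩).1 :=
      AnalyticAt.fun_comp (g := Θ.toFun) (f := fun z => z + q) (Θ.analytic _ trivial)
        (analyticAt_id.add analyticAt_const)
    have h2 := (h1.div ((Θ.analytic _ trivial).mul (analyticAt_const (v := Θ.toFun q)))
      (mul_ne_zero (h0 _) hq)).mul ((Θ.dlog q).analyticAt (γ ⟨t, ht⟩).1).neg.cexp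
    exact h2.congr (Filter.Eventually.of_forall fun z => (Θ.F_eq q z).symm)
  have hF' : ContDiffAt ℝ 1 (Θ.F q) (γ.extend t).1 := hF.contDiffAt.restrict_scalars ℝ
  have hfst : ContDiffWithinAt ℝ 1 (fun t => (γ.extend t).1) I t := (hγ t ht).fst
  exact ContDiffAt.comp_contDiffWithinAt (f := fun t => (γ.extend t).1) t hF' hfst

omit hsum h0 in
theorem curveIntegralFun_xi {t : ℝ} (ht : t ∈ I) (h0 : Θ.toFun (γ.extend t).1 ≠ 0)
    (hsum : Θ.toFun ((γ.extend t).1 + q) ≠ 0) : curveIntegralFun (Θ.xi m q) γ t =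
      derivWithin (fun t => Θ.F q (γ.extend t).1) I t / Θ.F q (γ.extend t).1 := by
  have h1 := (Θ.hasFDerivAt_F hq h0 hsum).differentiableAt.hasFDerivAt.restrictScalars ℝ
  have h2 : HasDerivWithinAt (fun t => (γ.extend t).1) (derivWithin γ.extend I t).1 I t :=
    (hγ.differentiableOn one_ne_zero t ht).hasDerivWithinAt.fst
  have h3 := (h1.comp_hasDerivWithinAt t h2).derivWithin (uniqueDiffOn_Icc_zero_one t ht)
  rw [curveIntegralFun_def]
  simp only [Function.comp_def] at h3
  rw [h3]
  simp [xi, div_eq_inv_mul]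

theorem curveIntegrable_xi : CurveIntegrable (Θ.xi m q) γ := by
  refine ContinuousOn.intervalIntegrable_of_Icc zero_le_one <|
    (continuousOn_derivWithin_div (Θ.contDiffOn_F_extend hγ h0 hq)
      (Θ.F_extend_ne_zero h0 hq hsum)).congr fun t ht => ?_
  apply Θ.curveIntegralFun_xi hγ hq ht <;> rw [γ.extend_apply ht]
  exacts [h0 _, hsum _]

theorem curveIntegral_xi_eq : curveIntegral (Θ.xi m q) γ = ∫ t in (0 : ℝ)..1,
    derivWithin (fun t => Θ.F q (γ.extend t).1) I t / Θ.F q (γ.extend t).1 := by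
  rw [curveIntegral_def]
  refine intervalIntegral.integral_congr fun t ht => ?_
  rw [Set.uIcc_of_le zero_le_one] at ht
  apply Θ.curveIntegralFun_xi hγ hq ht <;> rw [γ.extend_apply ht]
  exacts [h0 _, hsum _]

theorem exp_curveIntegral_xi_mul :
    Complex.exp (curveIntegral (Θ.xi m q) γ) * Θ.F q x.1 = Θ.F q y.1 := by
  rw [Θ.curveIntegral_xi_eq hγ h0 hq hsum]
  simpa using exp_integral_derivWithin_div (Θ.contDiffOn_F_extend hγ h0 hq)
    (Θ.F_extend_ne_zero h0 hq hsum) 1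

theorem curveIntegral_xiTilde {r : Fin m → Fin g → ℂ} {k : Fin m} (hr : r k = q) :
    curveIntegral (Θ.xiTilde r k) γ = curveIntegral (dt g k) γ + curveIntegral (Θ.xi m q) γ := by
  subst hr
  rw [xiTilde_eq_dt_add_xi]
  refine curveIntegral_add ?_ (Θ.curveIntegrable_xi hγ h0 hq hsum)
  exact (continuousOn_const (s := Set.univ)).curveIntegrable_of_contDiffOn hγ fun _ => trivial

end

omit hγ in
theorem curveIntegral_xi_zero : curveIntegral (Θ.xi m 0) γ = 0 := by
  rw [curveIntegral_def, intervalIntegral.integral_congr (g := fun _ => 0)]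
  · simp
  intro t ht
  rw [Set.uIcc_of_le zero_le_one] at ht
  have h : Θ.toFun (γ.extend t).1 ≠ 0 := by rw [γ.extend_apply ht]; exact h0 _
  simp only [curveIntegralFun_def, xi]
  rw [Θ.inv_F_smul_fderiv_F (by simp [Θ.map_zero]) h (by simpa using h)]
  simp

/-- The integrand is `d log θ(z + q) - d log θ(z) - d log θ(q)` applied to the velocity, and it is
jointly continuous because `hβ0`, `h0` and `hsum` keep all three arguments off the zeros of `θ`. -/
theorem continuous_curveIntegral_xi {β : I → Fin g → ℂ} (hβ : Continuous β)
    (hβ0 : ∀ u, Θ.toFun (β u) ≠ 0) (hsum : ∀ t u, Θ.toFun ((γ t).1 + β u) ≠ 0) :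
    Continuous fun u => curveIntegral (Θ.xi m (β u)) γ := by
  simp only [curveIntegral_def]
  refine continuous_intervalIntegral_of_continuousOn_prod ?_
  have hc : Continuous fun w : I × ℝ => (γ.extend w.2).1 :=
    continuous_fst.comp (γ.continuous_extend.comp continuous_snd)
  have hb : Continuous fun w : I × ℝ => β w.1 := hβ.comp continuous_fst
  have h1 : ∀ w ∈ (Set.univ ×ˢ I : Set (I × ℝ)), Θ.toFun (γ.extend w.2).1 ≠ 0 := fun w hw => by
    rw [γ.extend_apply hw.2]; exact h0 _
  have h2 : ∀ w ∈ (Set.univ ×ˢ I : Set (I × ℝ)), Θ.toFun ((γ.extend w.2).1 + β w.1) ≠ 0 :=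
    fun w hw => by rw [γ.extend_apply hw.2]; exact hsum _ _
  have hd : ContinuousOn (fun w : I × ℝ => (derivWithin γ.extend I w.2).1) (Set.univ ×ˢ I) :=
    continuous_fst.comp_continuousOn <|
      (hγ.continuousOn_derivWithin uniqueDiffOn_Icc_zero_one le_rfl).comp continuousOn_snd
        fun w hw => hw.2
  have key := (((Θ.continuousOn_dlog.comp (hc.add hb).continuousOn h2).sub
    (Θ.continuousOn_dlog.comp hc.continuousOn h1)).sub
    (Θ.continuousOn_dlog.comp hb.continuousOn fun w _ => hβ0 _)).clm_apply hd
  refine key.congr fun w hw => ?_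
  simp only [Function.uncurry, curveIntegralFun_def, xi]
  rw [Θ.inv_F_smul_fderiv_F (hβ0 _) (h1 w hw) (h2 w hw)]
  rfl

/-- As `q` is deformed along `β`, both sides are continuous logarithms of the multiplier of `F`, and
both vanish for `q = 0`. -/
theorem curveIntegral_xi_eq_period {v q : Fin g → ℂ} (hv : v ∈ T.lattice) (hy : y.1 = x.1 + v)
    (β : Path 0 q) (hβ0 : ∀ u, Θ.toFun (β u) ≠ 0)
    (hsum : ∀ t u, Θ.toFun ((γ t).1 + β u) ≠ 0) :
    curveIntegral (Θ.xi m q) γ = Θ.period q v := by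
  have := eq_of_continuous_of_exp_eq_exp
    (Θ.continuous_curveIntegral_xi hγ h0 β.continuous hβ0 hsum)
    (Θ.continuous_period_comp β.continuous hβ0 v)
    (by simp [Θ.curveIntegral_xi_zero h0]) (fun u => ?_) 1
  · simpa using this
  have h := Θ.exp_curveIntegral_xi_mul hγ h0 (hβ0 u) fun s => hsum s u
  rw [hy, Θ.F_add hv] at h
  refine mul_right_cancel₀ (Θ.F_ne_zero (hβ0 u) ?_ ?_) h
  · simpa using h0 0
  · simpa using hsum 0 u

end

theorem curveIntegral_xi_sub_eq_logRatio {m' : ℕ} {x : (Fin g → ℂ) × (Fin m → ℂ)}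
    {y : (Fin g → ℂ) × (Fin m' → ℂ)} {ρ : Path 0 x} {ρ' : Path 0 y}
    (hρ : ContDiffOn ℝ 1 ρ.extend I) (hρ' : ContDiffOn ℝ 1 ρ'.extend I)
    (h0 : ∀ s, Θ.toFun (ρ s).1 ≠ 0) (h0' : ∀ s, Θ.toFun (ρ' s).1 ≠ 0)
    (hsum : ∀ t u, Θ.toFun ((ρ t).1 + (ρ' u).1) ≠ 0) :
    curveIntegral (Θ.xi m y.1) ρ - curveIntegral (Θ.xi m' x.1) ρ' = Θ.logRatio x.1 y.1 := by
  have hx : Θ.toFun x.1 ≠ 0 := by simpa using h0 1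
  have hsum' : ∀ s, Θ.toFun ((ρ' s).1 + x.1) ≠ 0 := fun s => by
    simpa [add_comm] using hsum 1 s
  have hb : Continuous fun u => (ρ' u).1 := continuous_fst.comp ρ'.continuous
  have hF := Θ.contDiffOn_F_extend hρ' h0' hx
  have hFne := Θ.F_extend_ne_zero h0' hx hsum'
  -- Only the second point moves, along `ρ'`, while the first stays at `x.1`; at `u = 0` both sides
  -- vanish because `ξ_0 = 0` and `d log θ(0) = 0`.
  have := eq_of_continuous_of_exp_eq_exp
    ((Θ.continuous_curveIntegral_xi hρ h0 hb h0' hsum).sub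
      (continuous_integral_derivWithin_div hF hFne))
    (Θ.continuous_logRatio_comp (continuous_const (y := x.1)) hb (fun _ => hx) h0')
    (by simp [Θ.curveIntegral_xi_zero h0]) (fun u => ?_) 1
  · rw [Θ.curveIntegral_xi_eq hρ' h0' hx hsum']
    simpa using this
  have h1 := Θ.exp_curveIntegral_xi_mul hρ h0 (h0' u) fun s => hsum s u
  have h2 := exp_integral_derivWithin_div hF hFne u
  simp only [Prod.fst_zero, Θ.F_apply_zero (h0' u), mul_one] at h1
  simp only [Path.extend_zero, Prod.fst_zero, Θ.F_apply_zero hx, mul_one] at h2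
  rw [Pi.sub_apply, Complex.exp_sub, h1, h2, Θ.F_eq_exp_mul_F]
  have : Θ.F x.1 (ρ'.extend u).1 = Θ.F x.1 (ρ' u).1 := by rw [Path.extend_apply _ u.2]
  rw [this]
  exact mul_div_cancel_right₀ _ (Θ.F_ne_zero hx (h0' u) (hsum' u))

end Integrals

theorem exists_path {m : ℕ} {v : Fin g → ℂ} (hv : Θ.toFun v ≠ 0) (τ : Fin m → ℂ) :
    ∃ γ : Path (0 : (Fin g → ℂ) × (Fin m → ℂ)) (v, τ), ContDiffOn ℝ 1 γ.extend I ∧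
      ∀ s, Θ.toFun (γ s).1 ≠ 0 := by
  obtain ⟨s, hs⟩ := Θ.exists_arc_ne_zero hv
  have hc := contDiff_arc s
  have hsmul : ContDiff ℝ 1 fun t : ℝ => (arc s t • v, arc s t • τ) := by fun_prop
  let γ : Path (0 : (Fin g → ℂ) × (Fin m → ℂ)) (v, τ) :=
    { toFun := fun t => (arc s t • v, arc s t • τ)
      continuous_toFun := hsmul.continuous.comp continuous_subtype_val
      source' := by simp
      target' := by simp }
  exact ⟨γ, hsmul.contDiffOn.congr fun t ht => γ.extend_apply ht, fun t => hs t⟩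

theorem basis_mem_lattice (x : Fin g ⊕ Fin g) : T.basis x ∈ T.lattice :=
  Submodule.subset_span ⟨x, rfl⟩

/-! ### Loops -/

namespace Loop

variable {Θ} {m : ℕ} {r : Fin m → Fin g → ℂ} {v : Fin g → ℂ} (γ : Θ.Loop r v)

theorem curveIntegral_omega (j : Fin g) : curveIntegral (omega m j) γ.path = v j := by
  rw [Theta.curveIntegral_omega γ.contDiffOn, γ.target_fst]
  simp

theorem curveIntegral_eta (hv : v ∈ T.lattice) (j : Fin g) :
    curveIntegral (Θ.eta m j) γ.path = Real.pi * T.polar (Pi.single j 1) v := by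
  rw [Theta.curveIntegral_eta Θ γ.contDiffOn γ.ne_zero, γ.target_fst,
    Θ.h_add hv (by simpa using γ.ne_zero 0)]

theorem curveIntegral_xiG (k : Fin m) :
    curveIntegral (Θ.xiG r k) γ.path = -curveIntegral (dt g k) γ.path := by
  rw [xiG_eq_neg_dt, curveIntegral_neg]

theorem exists_int (hv : v ∈ T.lattice) (k : Fin m) : ∃ n : ℤ,
    curveIntegral (dt g k) γ.path + Θ.period (r k) v = n * (2 * Real.pi * Complex.I) := by
  have hsub : γ.target.1 - γ.source.1 = v := by simp [γ.target_fst]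
  have h := (Θ.expExt_eq_iff r (by rwa [hsub])).1 γ.closed.symm k
  rwa [hsub, ← curveIntegral_dt γ.contDiffOn] at h

theorem normalizedAt_iff (hv : v ∈ T.lattice) {k : Fin m} (hk : Θ.toFun (r k) ≠ 0) :
    γ.NormalizedAt Θ k ↔ curveIntegral (dt g k) γ.path + Θ.period (r k) v = 0 := by
  simp [NormalizedAt, Θ.isLogPeriod_iff hv hk]

theorem normalizedAt_iff_curveIntegral_xiTilde (hv : v ∈ T.lattice) {k : Fin m}
    (β : Path 0 (r k)) (hβ : ∀ u, Θ.toFun (β u) ≠ 0)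
    (hsum : ∀ t u, Θ.toFun ((γ.path t).1 + β u) ≠ 0) :
    γ.NormalizedAt Θ k ↔ curveIntegral (Θ.xiTilde r k) γ.path = 0 := by
  have hk : Θ.toFun (r k) ≠ 0 := by simpa using hβ 1
  rw [γ.normalizedAt_iff hv hk, Θ.curveIntegral_xiTilde γ.contDiffOn γ.ne_zero hk
    (fun s => by simpa using hsum s 1) rfl,
    Θ.curveIntegral_xi_eq_period γ.contDiffOn γ.ne_zero hv γ.target_fst β hβ hsum]

end Loop

theorem exists_normalized_loop {m : ℕ} {r : Fin m → Fin g → ℂ} {v : Fin g → ℂ}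
    (hv : v ∈ T.lattice) (hr : ∀ k, Θ.toFun (r k) ≠ 0) :
    ∃ γ : Θ.Loop r v, ∀ k, γ.NormalizedAt Θ k := by
  have hv0 : Θ.toFun v ≠ 0 := by
    simpa using (Θ.ne_zero_add_iff hv 0).2 (by simp [Θ.map_zero])
  -- The loop lifts to a path from the origin, and the final `t`-coordinates are those the
  -- normalization imposes.
  obtain ⟨γ, hγ, h0⟩ := Θ.exists_path hv0 fun k => -Θ.period (r k) v
  refine ⟨⟨0, _, γ, hγ, h0, by simp, ?_⟩, fun k => ?_⟩
  · exact ((Θ.expExt_eq_iff r (by simpa using hv)).2 fun k => ⟨0, by simp⟩).symm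
  · rw [Loop.normalizedAt_iff _ hv (hr k)]
    simp [curveIntegral_dt hγ]

/-! ### Open paths -/

theorem exists_log {m : ℕ} {r : Fin m → Fin g → ℂ} {z p : Fin g → ℂ} (w : Fin m → Additive ℂˣ)
    (h : z - p ∈ T.lattice) :
    ∃ x : (Fin g → ℂ) × (Fin m → ℂ), x.1 = p ∧ Θ.expExt r x = QuotientAddGroup.mk (z, w) := by
  -- This `t_k` solves `exp (t_k - d log θ(r_k)(p)) = w_k exp (π H(r_k, z - p))`, the fibre
  -- coordinate after moving the representative from `z` to `p`.
  refine ⟨(p, fun k => Complex.log ((w k).toMul : ℂ) + Θ.dlog (r k) p +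
    Real.pi * T.polar (r k) (-p + z)), rfl, ?_⟩
  rw [expExt, QuotientAddGroup.eq]
  refine ⟨by simpa [neg_add_eq_sub] using h, fun k => ?_⟩
  change (Complex.exp (Complex.log ((w k).toMul : ℂ) + Θ.dlog (r k) p +
    Real.pi * T.polar (r k) (-p + z) - ∑ j, Θ.h j (r k) * p j))⁻¹ * ((w k).toMul : ℂ) =
      Complex.exp (-(Real.pi * T.polar (r k) (-p + z)))
  rw [sum_h_mul, add_sub_right_comm, add_sub_cancel_right, Complex.exp_add,
    Complex.exp_log (Units.ne_zero _), Complex.exp_neg, mul_inv]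
  have := Units.ne_zero (w k).toMul
  field_simp

theorem exists_log_of_toA {m : ℕ} {r : Fin m → Fin g → ℂ} {p : Fin g → ℂ} {R : T.Ext r}
    (h : PPTorus.Ext.toA T r R = T.expA p) :
    ∃ x : (Fin g → ℂ) × (Fin m → ℂ), x.1 = p ∧ Θ.expExt r x = R := by
  obtain ⟨⟨z, w⟩, rfl⟩ := QuotientAddGroup.mk_surjective R
  exact Θ.exists_log w ((Submodule.Quotient.eq _).1 h)

theorem exists_log_of_toDual {m : ℕ} {r : Fin m → Fin g → ℂ} {p : Fin g → ℂ} {R : T.Ext r}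
    (h : PPTorus.Ext.toDual T r R = T.expDual (T.polar p)) :
    ∃ x : (Fin g → ℂ) × (Fin m → ℂ), x.1 = p ∧ Θ.expExt r x = R := by
  obtain ⟨⟨z, w⟩, rfl⟩ := QuotientAddGroup.mk_surjective R
  refine Θ.exists_log w ?_
  have h1 := QuotientAddGroup.eq.1 h
  rw [← map_neg, ← map_add, polar_mem_dualLattice_iff] at h1
  simpa [sub_eq_add_neg, add_comm] using neg_mem h1

theorem exists_openPath {m : ℕ} {r : Fin m → Fin g → ℂ} {p : Fin g → ℂ} {R : T.Ext r}
    (hp : Θ.toFun p ≠ 0) {x : (Fin g → ℂ) × (Fin m → ℂ)} (hx : x.1 = p)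
    (hR : Θ.expExt r x = R) : ∃ ρ : Θ.OpenPath r p R, ρ.log = x := by
  subst hx
  obtain ⟨γ, hγ, h0⟩ := Θ.exists_path hp x.2
  exact ⟨⟨x, rfl, hR, γ, hγ, h0⟩, rfl⟩

/-- Both logarithms lie above the same point `(p i, q k)` of the cover, so the lattice elements
relating them are zero and the fibre coordinates themselves agree. -/
theorem exists_int_of_toPoincare_eq {n s : ℕ} {p : Fin n → Fin g → ℂ} {q : Fin s → Fin g → ℂ}
    {i : Fin n} {k : Fin s} {x : (Fin g → ℂ) × (Fin s → ℂ)} {y : (Fin g → ℂ) × (Fin n → ℂ)}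
    (hx : x.1 = p i) (hy : y.1 = q k)
    (h : PPTorus.Ext.toPoincare T q k (Θ.expExt q x) =
      PPTorus.Ext.toPoincare' T p i (Θ.expExt p y)) :
    ∃ m : ℤ, x.2 k - y.2 i + Θ.logRatio (p i) (q k) = m * (2 * Real.pi * Complex.I) := by
  obtain ⟨v, -, v', -, h1, h2, h3⟩ := Quotient.exact h
  change p i = x.1 + v at h1
  change y.1 = q k + v' at h2
  change Complex.exp (y.2 i - ∑ j, Θ.h j (p i) * y.1 j) =
    Complex.exp (x.2 k - ∑ j, Θ.h j (q k) * x.1 j) *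
      Complex.exp (-(Real.pi * (T.polar (q k) v + T.polar x.1 v' + T.polar v' v))) at h3
  obtain rfl : v = 0 := by simpa [hx] using h1
  obtain rfl : v' = 0 := by simpa [hy] using h2
  rw [sum_h_mul, sum_h_mul, hx, hy] at h3
  simp only [_root_.map_zero, add_zero, mul_zero, neg_zero, Complex.exp_zero, mul_one] at h3
  obtain ⟨m, hm⟩ := Complex.exp_eq_exp_iff_exists_int.1 h3.symm
  exact ⟨m, by rw [logRatio]; linear_combination hm⟩

namespace OpenPath

variable {Θ}

section

variable {m : ℕ} {r : Fin m → Fin g → ℂ} {p : Fin g → ℂ} {R : T.Ext r} (ρ : Θ.OpenPath r p R)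

theorem curveIntegral_dt (k : Fin m) : curveIntegral (dt g k) ρ.path = ρ.log.2 k := by
  rw [Theta.curveIntegral_dt ρ.contDiffOn]
  simp

theorem curveIntegral_xiG (k : Fin m) : curveIntegral (Θ.xiG r k) ρ.path = -ρ.log.2 k := by
  rw [Theta.curveIntegral_xiG Θ ρ.contDiffOn]
  simp

theorem curveIntegral_omega (j : Fin g) : curveIntegral (omega m j) ρ.path = p j := by
  rw [Theta.curveIntegral_omega ρ.contDiffOn, ρ.log_fst]
  simp

theorem curveIntegral_eta (j : Fin g) : curveIntegral (Θ.eta m j) ρ.path = Θ.h j p := by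
  rw [Theta.curveIntegral_eta Θ ρ.contDiffOn ρ.ne_zero, ρ.log_fst]
  simp

end

variable {n s : ℕ} {p : Fin n → Fin g → ℂ} {q : Fin s → Fin g → ℂ} {i : Fin n} {k : Fin s}
  {R : T.Ext q} {R' : T.Ext p} (ρ : Θ.OpenPath q (p i) R) (ρ' : Θ.OpenPath p (q k) R')

theorem compatibleAt_iff (hp : Θ.toFun (p i) ≠ 0) (hq : Θ.toFun (q k) ≠ 0) :
    ρ.CompatibleAt Θ ρ' ↔ ρ.log.2 k - ρ'.log.2 i + Θ.logRatio (p i) (q k) = 0 := by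
  simp [CompatibleAt, Θ.isLogRatio_iff hp hq, curveIntegral_dt]

theorem compatibleAt_iff_curveIntegral_xiTilde
    (hsum : ∀ t u, Θ.toFun ((ρ.path t).1 + (ρ'.path u).1) ≠ 0) :
    ρ.CompatibleAt Θ ρ' ↔
      curveIntegral (Θ.xiTilde q k) ρ.path - curveIntegral (Θ.xiTilde p i) ρ'.path = 0 := by
  have hp : Θ.toFun (p i) ≠ 0 := by simpa [ρ.log_fst] using ρ.ne_zero 1
  have hq : Θ.toFun (q k) ≠ 0 := by simpa [ρ'.log_fst] using ρ'.ne_zero 1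
  have h := Θ.curveIntegral_xi_sub_eq_logRatio ρ.contDiffOn ρ'.contDiffOn ρ.ne_zero ρ'.ne_zero hsum
  rw [ρ.log_fst, ρ'.log_fst] at h
  rw [ρ.compatibleAt_iff ρ' hp hq,
    Θ.curveIntegral_xiTilde ρ.contDiffOn ρ.ne_zero hq
      (fun t => by simpa [ρ'.log_fst] using hsum t 1) rfl,
    Θ.curveIntegral_xiTilde ρ'.contDiffOn ρ'.ne_zero hp
      (fun t => by simpa [ρ.log_fst, add_comm] using hsum 1 t) rfl,
    ρ.curveIntegral_dt, ρ'.curveIntegral_dt, ← h]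
  ring_nf

end OpenPath

/-! ### The right-hand sides of the relations -/

section Matrices

variable {n s : ℕ} {p : Fin n → Fin g → ℂ} {q : Fin s → Fin g → ℂ}
  {R : Fin n → T.Ext q} {R' : Fin s → T.Ext p}

theorem sum_polar_single_mul (q v : Fin g → ℂ) :
    ∑ j, T.polar (Pi.single j 1) v * q j = T.polar q v :=
  (apply_eq_sum_mul_single (T.polar.flip v) q).symm

theorem period_eq_sum (q v : Fin g → ℂ) :
    Θ.period q v = ∑ j, (Real.pi * T.polar (Pi.single j 1) v * q j - v j * Θ.h j q) := by
  rw [period, ← sum_polar_single_mul, ← sum_h_mul, Finset.mul_sum, ← Finset.sum_sub_distrib]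
  exact Finset.sum_congr rfl fun j _ => by ring

theorem neg_PiA_mul_logDual_transpose (γ : ∀ x, Θ.Loop q (T.basis x))
    (ρ' : ∀ k, Θ.OpenPath p (q k) (R' k)) (x : Fin g ⊕ Fin g) (k : Fin s) :
    (-(Θ.PiA γ * (Θ.logDual ρ').transpose)) x k = Θ.period (q k) (T.basis x) := by
  rw [period_eq_sum, Matrix.neg_apply, Matrix.mul_apply, Fintype.sum_sum_type,
    ← Finset.sum_add_distrib, ← Finset.sum_neg_distrib]
  refine Finset.sum_congr rfl fun j _ => ?_
  simp only [PiA, logDual, baseA, baseDual, Matrix.of_apply, Matrix.transpose_apply, Sum.elim_inl,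
    Sum.elim_inr, curveIntegral_neg, (γ x).curveIntegral_omega,
    (γ x).curveIntegral_eta (basis_mem_lattice x), (ρ' k).curveIntegral_omega,
    (ρ' k).curveIntegral_eta]
  ring

theorem neg_PiDual_mul_logA_transpose (γ' : ∀ x, Θ.Loop p (T.basis x))
    (ρ : ∀ i, Θ.OpenPath q (p i) (R i)) (x : Fin g ⊕ Fin g) (i : Fin n) :
    (-(Θ.PiDual γ' * (Θ.logA ρ).transpose)) x i =
      Sum.elim (fun l => -Θ.period (p i) (T.basis (Sum.inr l)))
        (fun l => Θ.period (p i) (T.basis (Sum.inl l))) x := by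
  rw [Matrix.neg_apply, Matrix.mul_apply, Fintype.sum_sum_type, ← Finset.sum_add_distrib]
  rcases x with l | l <;> simp only [Sum.elim_inl, Sum.elim_inr, period_eq_sum,
    ← Finset.sum_neg_distrib] <;>
  refine Finset.sum_congr rfl fun j _ => ?_ <;>
  simp only [PiDual, dualLoopIntegral, logA, baseA, baseDual, Matrix.of_apply,
    Matrix.transpose_apply, Sum.elim_inl, Sum.elim_inr, curveIntegral_neg,
    (γ' _).curveIntegral_omega, (γ' _).curveIntegral_eta (basis_mem_lattice _),
    (ρ i).curveIntegral_omega, (ρ i).curveIntegral_eta] <;>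
  ring

theorem neg_logDual_mul_logA_transpose (ρ : ∀ i, Θ.OpenPath q (p i) (R i))
    (ρ' : ∀ k, Θ.OpenPath p (q k) (R' k)) (k : Fin s) (i : Fin n) :
    (-(Θ.logDual ρ' * (Θ.logA ρ).transpose)) k i = Θ.logRatio (p i) (q k) := by
  rw [logRatio, ← sum_h_mul, ← sum_h_mul, ← Finset.sum_sub_distrib, Matrix.neg_apply,
    Matrix.mul_apply, Fintype.sum_sum_type, ← Finset.sum_add_distrib, ← Finset.sum_neg_distrib]
  refine Finset.sum_congr rfl fun j _ => ?_
  simp only [logA, logDual, baseA, baseDual, Matrix.of_apply, Matrix.transpose_apply, Sum.elim_inl,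
    Sum.elim_inr, curveIntegral_neg, (ρ i).curveIntegral_omega, (ρ i).curveIntegral_eta,
    (ρ' k).curveIntegral_omega, (ρ' k).curveIntegral_eta]
  ring

theorem XiR_transpose_add_XiDual (ρ : ∀ i, Θ.OpenPath q (p i) (R i))
    (ρ' : ∀ k, Θ.OpenPath p (q k) (R' k)) (k : Fin s) (i : Fin n) :
    ((Θ.XiR ρ).transpose + Θ.XiDual ρ') k i = (ρ' k).log.2 i - (ρ i).log.2 k := by
  simp only [Matrix.add_apply, Matrix.transpose_apply, XiR, XiDual, Matrix.of_apply,
    OpenPath.curveIntegral_xiG]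
  ring

end Matrices

end PPTorus.Theta

end

/-! ### The reciprocity relations -/

theorem mainTheorem6 {g n s : ℕ} (T : PPTorus g) (Θ : T.Theta)
    (P : Fin n → T.A) (Q : Fin s → T.Dual)
    (p : Fin n → Fin g → ℂ) (q : Fin s → Fin g → ℂ)
    (hp : ∀ i, T.expA (p i) = P i) (hq : ∀ k, T.expDual (T.polar (q k)) = Q k)
    (hpθ : ∀ i, Θ.toFun (p i) ≠ 0) (hqθ : ∀ k, Θ.toFun (q k) ≠ 0)
    (ψ : Fin n → Fin s → T.Poincare) (hψ : ∀ i k, PPTorus.Poincare.base T (ψ i k) = (P i, Q k))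
    (R : Fin n → T.Ext q) (hR : ∀ i, PPTorus.Ext.toA T q (R i) = P i)
    (hRψ : ∀ i k, PPTorus.Ext.toPoincare T q k (R i) = ψ i k)
    (R' : Fin s → T.Ext p) (hR' : ∀ k, PPTorus.Ext.toDual T p (R' k) = Q k)
    (hR'ψ : ∀ k i, PPTorus.Ext.toPoincare' T p i (R' k) = ψ i k) :
    -- the three relations, for all normalized choices of loops and paths
    (∀ (γ : ∀ x, Θ.Loop q (T.basis x)) (γ' : ∀ x, Θ.Loop p (T.basis x))
        (ρ : ∀ i, Θ.OpenPath q (p i) (R i)) (ρ' : ∀ k, Θ.OpenPath p (q k) (R' k)),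
      ((∀ x k, (γ x).NormalizedAt Θ k) →
        Θ.UpsilonQ γ = -(Θ.PiA γ * (Θ.logDual ρ').transpose)) ∧
      ((∀ x i, (γ' x).NormalizedAt Θ i) →
        Θ.UpsilonP γ' = -(Θ.PiDual γ' * (Θ.logA ρ).transpose)) ∧
      ((∀ i k, (ρ i).CompatibleAt Θ (ρ' k)) →
        (Θ.XiR ρ).transpose + Θ.XiDual ρ' = -(Θ.logDual ρ' * (Θ.logA ρ).transpose))) ∧
    -- normalized choices exist
    (∃ γ : ∀ x, Θ.Loop q (T.basis x), ∀ x k, (γ x).NormalizedAt Θ k) ∧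
    (∃ γ' : ∀ x, Θ.Loop p (T.basis x), ∀ x i, (γ' x).NormalizedAt Θ i) ∧
    (∃ (ρ : ∀ i, Θ.OpenPath q (p i) (R i)) (ρ' : ∀ k, Θ.OpenPath p (q k) (R' k)),
      ∀ i k, (ρ i).CompatibleAt Θ (ρ' k)) ∧
    -- for arbitrary choices the relations hold modulo `2 i π ℤ`
    (∀ (γ : ∀ x, Θ.Loop q (T.basis x)) (γ' : ∀ x, Θ.Loop p (T.basis x))
        (ρ : ∀ i, Θ.OpenPath q (p i) (R i)) (ρ' : ∀ k, Θ.OpenPath p (q k) (R' k)),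
      (Θ.UpsilonQ γ).CongrTwoPiI (-(Θ.PiA γ * (Θ.logDual ρ').transpose)) ∧
      (Θ.UpsilonP γ').CongrTwoPiI (-(Θ.PiDual γ' * (Θ.logA ρ).transpose)) ∧
      ((Θ.XiR ρ).transpose + Θ.XiDual ρ').CongrTwoPiI
        (-(Θ.logDual ρ' * (Θ.logA ρ).transpose))) ∧
    -- the normalizations are the vanishing of the integrals of `ξ̃` along the chosen paths
    -- whenever the deformations do not meet the poles
    (∀ (x : Fin g ⊕ Fin g) (k : Fin s) (γ : Θ.Loop q (T.basis x)) (β : Path 0 (q k)),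
      (∀ u, Θ.toFun (β u) ≠ 0) → (∀ t u, Θ.toFun ((γ.path t).1 + β u) ≠ 0) →
      (γ.NormalizedAt Θ k ↔ curveIntegral (Θ.xiTilde q k) γ.path = 0)) ∧
    (∀ (x : Fin g ⊕ Fin g) (i : Fin n) (γ' : Θ.Loop p (T.basis x)) (α : Path 0 (p i)),
      (∀ u, Θ.toFun (α u) ≠ 0) → (∀ t u, Θ.toFun ((γ'.path t).1 + α u) ≠ 0) →
      (γ'.NormalizedAt Θ i ↔ curveIntegral (Θ.xiTilde p i) γ'.path = 0)) ∧
    (∀ (i : Fin n) (k : Fin s) (ρ : Θ.OpenPath q (p i) (R i)) (ρ' : Θ.OpenPath p (q k) (R' k)),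
      (∀ t u, Θ.toFun ((ρ.path t).1 + (ρ'.path u).1) ≠ 0) →
      (ρ.CompatibleAt Θ ρ' ↔
        curveIntegral (Θ.xiTilde q k) ρ.path - curveIntegral (Θ.xiTilde p i) ρ'.path = 0)) := by

  have hb := fun x => PPTorus.Theta.basis_mem_lattice (T := T) x
  -- This is where the common points `ψ i k` enter: they tie `R i` to `R' k` up to `2πiℤ`.
  have hcongr : ∀ (ρ : ∀ i, Θ.OpenPath q (p i) (R i)) (ρ' : ∀ k, Θ.OpenPath p (q k) (R' k)) i k,
      ∃ m : ℤ, (ρ i).log.2 k - (ρ' k).log.2 i + Θ.logRatio (p i) (q k) =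
        m * (2 * Real.pi * Complex.I) := fun ρ ρ' i k => by
    refine Θ.exists_int_of_toPoincare_eq (ρ i).log_fst (ρ' k).log_fst ?_
    rw [(ρ i).exp_log, (ρ' k).exp_log, hRψ, hR'ψ]
  refine ⟨fun γ γ' ρ ρ' => ⟨fun h => ?_, fun h => ?_, fun h => ?_⟩, ?_, ?_, ?_,
    fun γ γ' ρ ρ' => ⟨fun x k => ?_, fun x i => ?_, fun k i => ?_⟩,
    fun x k γ β hβ hsum => γ.normalizedAt_iff_curveIntegral_xiTilde (hb x) β hβ hsum,
    fun x i γ' α hα hsum => γ'.normalizedAt_iff_curveIntegral_xiTilde (hb x) α hα hsum,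
    fun i k ρ ρ' hsum => ρ.compatibleAt_iff_curveIntegral_xiTilde ρ' hsum⟩
  · ext x k
    rw [Θ.neg_PiA_mul_logDual_transpose]
    have := ((γ x).normalizedAt_iff (hb x) (hqθ k)).1 (h x k)
    simp only [PPTorus.Theta.UpsilonQ, Matrix.of_apply, (γ x).curveIntegral_xiG]
    linear_combination -this
  · ext x i
    rw [Θ.neg_PiDual_mul_logA_transpose]
    have := fun x => ((γ' x).normalizedAt_iff (hb x) (hpθ i)).1 (h x i)
    rcases x with l | l <;> simp only [PPTorus.Theta.UpsilonP, PPTorus.Theta.dualLoopIntegral,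
      Matrix.of_apply, Sum.elim_inl, Sum.elim_inr, (γ' _).curveIntegral_xiG]
    · linear_combination this (Sum.inr l)
    · linear_combination -this (Sum.inl l)
  · ext k i
    rw [Θ.neg_logDual_mul_logA_transpose, Θ.XiR_transpose_add_XiDual]
    linear_combination -((ρ i).compatibleAt_iff (ρ' k) (hpθ i) (hqθ k)).1 (h i k)
  · choose γ hγ using fun x => Θ.exists_normalized_loop (hb x) hqθ
    exact ⟨γ, hγ⟩
  · choose γ hγ using fun x => Θ.exists_normalized_loop (hb x) hpθ
    exact ⟨γ, hγ⟩
  · choose x hx hxR using fun i => Θ.exists_log_of_toA ((hR i).trans (hp i).symm)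
    choose y hy hyR using fun k => Θ.exists_log_of_toDual ((hR' k).trans (hq k).symm)
    choose ρ hρ using fun i => Θ.exists_openPath (hpθ i) (hx i) (hxR i)
    -- Logarithms of the `R i` may be arbitrary. Compatibility then prescribes each coordinate of
    -- the logarithm of `R' k`, and the prescribed value differs from an actual one by a multiple of
    -- `2πi`.
    have hy' : ∀ k, Θ.expExt p (q k, fun i => (x i).2 k + Θ.logRatio (p i) (q k)) = R' k := by
      intro k
      rw [← hyR k, eq_comm, Θ.expExt_eq_iff p (by simp [hy])]
      intro i
      obtain ⟨m, hm⟩ := Θ.exists_int_of_toPoincare_eq (hx i) (hy k)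
        (by rw [hxR, hyR, hRψ, hR'ψ])
      refine ⟨m, ?_⟩
      -- Both logarithms lie above `q k`, so the period is taken at `0` and drops out.
      rw [hy k, ← hm, sub_self, PPTorus.Theta.period]
      simp
      ring
    choose ρ' hρ' using fun k => Θ.exists_openPath (hqθ k) rfl (hy' k)
    refine ⟨ρ, ρ', fun i k => ((ρ i).compatibleAt_iff (ρ' k) (hpθ i) (hqθ k)).2 ?_⟩
    rw [hρ, hρ']
    ring
  · obtain ⟨m, hm⟩ := (γ x).exists_int (hb x) k
    refine ⟨-m, ?_⟩
    rw [Θ.neg_PiA_mul_logDual_transpose]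
    simp only [PPTorus.Theta.UpsilonQ, Matrix.of_apply, (γ x).curveIntegral_xiG]
    push_cast
    linear_combination -hm
  · rw [Θ.neg_PiDual_mul_logA_transpose]
    rcases x with l | l <;> simp only [PPTorus.Theta.UpsilonP, PPTorus.Theta.dualLoopIntegral,
      Matrix.of_apply, Sum.elim_inl, Sum.elim_inr, (γ' _).curveIntegral_xiG]
    · obtain ⟨m, hm⟩ := (γ' (Sum.inr l)).exists_int (hb _) i
      exact ⟨m, by linear_combination hm⟩
    · obtain ⟨m, hm⟩ := (γ' (Sum.inl l)).exists_int (hb _) i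
      exact ⟨-m, by push_cast; linear_combination -hm⟩
  · obtain ⟨m, hm⟩ := hcongr ρ ρ' i k
    refine ⟨-m, ?_⟩
    rw [Θ.neg_logDual_mul_logA_transpose, Θ.XiR_transpose_add_XiDual]
    push_cast
    linear_combination -hm
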